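/- For a finite set $E$ and a monotone submodular $f\colon 2^E\to\mathbb Z$, let $\mathcal M_f$ be the matroid induced by $f$: $F\subseteq E$ is independent if and only if $|I|\le f(I)$ for all nonempty $I\subseteq F$. For a graph $G=(V,E)$, the $(k,\ell)$-count matroid of $G$ is $\mathcal M_{c_{k,\ell}}$ with $c_{k,\ell}(F)=k|V(F)|-\ell$, where $V(F)$ is the set of vertices incident to edges of $F$; the $(1,1)$- and $(1,0)$-count matroids are the graphic and the bicircular matroid of $G$. For an irreducible variety $X\subseteq\mathbb C^E$, the algebraic matroid $\mathcal M(X)$ has as independent sets those $I\subseteq E$ for which the coordinate projection of $X$ to $\mathbb C^I$ is Zariski dense. The Hadamard product $X_1*\cdots*X_d$ is the Zariski closure of the set of coordinatewise products $x_1*\cdots*x_d$ with $x_i\in X_i$. In the weak order, $\mathcal N_1\preceq\mathcal N_2$ means that every independent set of $\mathcal N_1$ is independent in $\mathcal N_2$. Let $G=(V,E)$ be the graph with $20$ vertices $(i,j)$, $i\in\mathbb Z/4$, $0\le j\le 4$, in which for each $i$ the six vertices $(i,0),\dots,(i,4),(i+1,0)$ span a $K_6$ minus the edge joining $(i,0)$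 and $(i+1,0)$, and which has no other edges. Then: 1. $G$ is $(3,4)$-tight: $E$ is independent in the $(3,4)$-count matroid of $G$, and $|E|=3|V|-4$. 2. The graphic and the bicircular matroid of $G$ are representable over $\mathbb C$. Let $X_{1,1}$ and $X_{1,0}$ be any complex matrices, with rows indexed by $E$, that represent the graphic and the bicircular matroid of $G$, respectively, as row matroids, and let $L_{1,1},L_{1,0}\subseteq\mathbb C^E$ be their column spaces. Then neither space is contained in a coordinate hyperplane, $\mathcal M(L_{1,1})$ is the graphic matroid and $\mathcal M(L_{1,0})$ is the bicircular matroid of $G$. 3. With $r_1=r_2$ the rank function of $\mathcal M(L_{1,1})$ and $r_3$ that of $\mathcal M(L_{1,0})$, the matroid $\mathcal M(L_{1,1}*L_{1,1}*L_{1,0})$ is strictly smaller in the weak order than $\mathcal M_{r_1+r_2+r_3-2}$. The rank of $\mathcal M(L_{1,1}*L_{1,1}*L_{1,0})$ is at most $3|V|-5$, whereas $\mathcal M_{r_1+r_2+r_3-2}$ is the $(3,4)$-count matroid of $G$ and has rank $3|V|-4$. Consequently the following conjecture of Bernstein fails for $d=3$: if $L_1,\dots,L_d\subset\mathbb C^m$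 are linear spaces not contained in any coordinate hyperplane, with rank functions $r_1,\dots,r_d$, then $\mathcal M(L_1*\cdots*L_d)=\mathcal M_{r_1+\cdots+r_d-(d-1)}$. -/

import Mathlib

open MvPolynomial

/-! ### Matroids induced by monotone submodular functions -/

/-- An integer-valued monotone submodular set function on `E`; no condition on its value at `∅`. -/
structure MonotoneSubmodular (E : Type*) where
  toFun : Set E → ℤ
  mono : ∀ A B : Set E, A ⊆ B → toFun A ≤ toFun B
  submod : ∀ A B : Set E, toFun (A ∪ B) + toFun (A ∩ B) ≤ toFun A + toFun B

/-- `F` belongs to `I_f` if `|I| ≤ f(I)` for every nonempty `I ⊆ F`. -/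
def InducedIndep {E : Type*} (f : MonotoneSubmodular E) (F : Set E) : Prop :=
  ∀ I : Set E, I ⊆ F → I.Nonempty → (I.ncard : ℤ) ≤ f.toFun I

theorem InducedIndep.exists_insert {E : Type*} [Finite E] (f : MonotoneSubmodular E)
    {I J : Set E} (hI : InducedIndep f I) (hJ : InducedIndep f J) (hlt : I.ncard < J.ncard) :
    ∃ e ∈ J, e ∉ I ∧ InducedIndep f (insert e I) := by
  classical
  obtain ⟨_⟩ := nonempty_fintype E
  by_contra hcon
  push Not at hcon
  -- tight subsets of `I`
  let T : Set E → Prop := fun A => A ⊆ I ∧ A.Nonempty ∧ f.toFun A = A.ncard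
  have hTunion : ∀ A B, T A → T B → (A ∩ B).Nonempty → T (A ∪ B) := by
    rintro A B ⟨hAI, hA, hfA⟩ ⟨hBI, hB, hfB⟩ hAB
    refine ⟨Set.union_subset hAI hBI, hA.mono Set.subset_union_left, ?_⟩
    have h1 := hI (A ∪ B) (Set.union_subset hAI hBI) (hA.mono Set.subset_union_left)
    have h2 := hI (A ∩ B) (Set.inter_subset_left.trans hAI) hAB
    have h3 := f.submod A B
    have h4 := Set.ncard_union_add_ncard_inter A B
    have h5 : ((A ∪ B).ncard : ℤ) + (A ∩ B).ncard = A.ncard + B.ncard := by exact_mod_cast h4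
    linarith
  have hspan : ∀ e ∈ J, e ∉ I → ∃ A, T A ∧ f.toFun (insert e A) = f.toFun A := by
    intro e heJ heI
    have h := hcon e heJ heI
    simp only [InducedIndep, not_forall, not_le] at h
    obtain ⟨S, hS, hSne, hSlt⟩ := h
    have heS : e ∈ S := by
      by_contra heS
      have : S ⊆ I := fun x hx => (hS hx).resolve_left (fun h => heS (h ▸ hx))
      exact absurd (hI S this hSne) (not_le.2 hSlt)
    have hAI : S \ {e} ⊆ I := fun x hx => (hS hx.1).resolve_left hx.2
    have hins : insert e (S \ {e}) = S := by
      rw [Set.insert_sdiff_singleton, Set.insert_eq_of_mem heS]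
    have hcard : S.ncard = (S \ {e}).ncard + 1 := by
      conv_lhs => rw [← hins]
      exact Set.ncard_insert_of_notMem (fun h => h.2 rfl)
    have hAne : (S \ {e}).Nonempty := by
      rw [Set.nonempty_iff_ne_empty]
      intro h0
      have hSe : S = {e} := by rw [← hins, h0]; simp
      have h1 := hJ {e} (by simpa using heJ) ⟨e, rfl⟩
      rw [hSe] at hSlt
      linarith
    have h1 := hI _ hAI hAne
    have h2 := f.mono (S \ {e}) S Set.sdiff_subset
    rw [hcard] at hSlt
    push_cast at hSlt
    refine ⟨S \ {e}, ⟨hAI, hAne, by linarith⟩, ?_⟩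
    rw [hins]
    linarith
  -- maximal tight subsets of `I`
  let P : Finset (Set E) := Finset.univ.filter (fun A => Maximal T A)
  have hP : ∀ A, A ∈ P ↔ Maximal T A := fun A => by simp [P]
  have hdisj : ∀ A ∈ P, ∀ B ∈ P, A ≠ B → Disjoint A B := by
    intro A hA B hB hne
    rw [hP] at hA hB
    rw [Set.disjoint_iff_inter_eq_empty]
    by_contra h
    have h := hTunion A B hA.prop hB.prop (Set.nonempty_iff_ne_empty.2 h)
    exact hne ((hA.eq_of_subset h Set.subset_union_left).trans
      (hB.eq_of_subset h Set.subset_union_right).symm)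
  have hspan' : ∀ e ∈ J, e ∉ I → ∃ A ∈ P, f.toFun (insert e A) = f.toFun A := by
    intro e heJ heI
    obtain ⟨A, hA, hfA⟩ := hspan e heJ heI
    obtain ⟨B, hAB, hB⟩ := Finite.exists_le_maximal hA
    have hAB : A ⊆ B := hAB
    refine ⟨B, (hP B).2 hB, le_antisymm ?_ (f.mono _ _ (Set.subset_insert _ _))⟩
    have heB : e ∉ B := fun h => heI (hB.prop.1 h)
    have h := f.submod (insert e A) B
    have h1 : insert e A ∪ B = insert e B := by
      rw [Set.insert_union, Set.union_eq_self_of_subset_left hAB]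
    have h2 : insert e A ∩ B = A := by
      rw [Set.insert_inter_of_notMem heB, Set.inter_eq_self_of_subset_left hAB]
    rw [h1, h2] at h
    linarith
  let N : Set E → Set E := fun A => {e | e ∈ J ∧ e ∉ I ∧ f.toFun (insert e A) = f.toFun A}
  have hadd : ∀ A : Set E, ∀ K : Finset E, (∀ e ∈ K, f.toFun (insert e A) = f.toFun A) →
      f.toFun (A ∪ K) = f.toFun A := by
    intro A K
    induction K using Finset.induction_on with
    | empty => intro _; simp
    | insert a K ha ih =>
      intro h
      have ih := ih (fun e he => h e (Finset.mem_insert_of_mem he))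
      have ha := h a (Finset.mem_insert_self _ _)
      refine le_antisymm ?_ (f.mono _ _ Set.subset_union_left)
      have h1 := f.submod (A ∪ K) (insert a A)
      have h2 : (A ∪ K) ∪ insert a A = A ∪ ((insert a K : Finset E) : Set E) := by
        ext x; simp; tauto
      have h3 := f.mono A ((A ∪ K) ∩ insert a A)
        (Set.subset_inter Set.subset_union_left (Set.subset_insert _ _))
      rw [h2] at h1
      linarith
  have hkey : ∀ A ∈ P, (J ∩ A).ncard + (N A).ncard ≤ A.ncard := by
    intro A hA
    have hT := ((hP A).1 hA).prop
    have h1 : f.toFun (A ∪ N A) = A.ncard := by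
      have := hadd A (N A).toFinset (fun e he => (Set.mem_toFinset.1 he).2.2)
      rw [Set.coe_toFinset] at this
      rw [this, hT.2.2]
    have hd : Disjoint (J ∩ A) (N A) :=
      Set.disjoint_left.2 fun x hx hx' => hx'.2.1 (hT.1 hx.2)
    have h2 := Set.ncard_union_eq hd
    rw [← h2]
    rcases Set.eq_empty_or_nonempty (J ∩ A ∪ N A) with h0 | h0
    · simp [h0]
    · have h3 := hJ _ (Set.union_subset Set.inter_subset_left (fun x hx => hx.1)) h0
      have h4 := f.mono (J ∩ A ∪ N A) (A ∪ N A)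
        (Set.union_subset_union_left _ Set.inter_subset_right)
      rw [h1] at h4
      exact_mod_cast h3.trans h4
  have hJI : (J \ I).ncard ≤ ∑ A ∈ P, (N A).ncard := by
    have : J \ I ⊆ ⋃ A ∈ P, N A := by
      intro e he
      obtain ⟨A, hA, h⟩ := hspan' e he.1 he.2
      exact Set.mem_biUnion hA ⟨he.1, he.2, h⟩
    exact (Set.ncard_le_ncard this).trans (Finset.set_ncard_biUnion_le P N)
  have hIJ : ∑ A ∈ P, (A \ J).ncard ≤ (I \ J).ncard := by
    have : ∀ Q : Finset (Set E), Q ⊆ P →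
        ∑ A ∈ Q, (A \ J).ncard = (⋃ A ∈ Q, (A \ J)).ncard := by
      intro Q
      induction Q using Finset.induction_on with
      | empty => intro _; simp
      | insert B Q hB ih =>
        intro hQ
        rw [Finset.sum_insert hB, ih (fun x hx => hQ (Finset.mem_insert_of_mem hx)),
          Finset.set_biUnion_insert, Set.ncard_union_eq]
        rw [Set.disjoint_iUnion₂_right]
        intro A hA
        refine (hdisj B (hQ (Finset.mem_insert_self _ _)) A
          (hQ (Finset.mem_insert_of_mem hA)) ?_).mono Set.sdiff_subset Set.sdiff_subset
        rintro rfl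
        exact hB hA
    rw [this P subset_rfl]
    refine Set.ncard_le_ncard (Set.iUnion₂_subset fun A hA => ?_)
    exact Set.sdiff_subset_sdiff_left ((hP A).1 hA).prop.1
  have hsum : ∑ A ∈ P, (N A).ncard ≤ ∑ A ∈ P, (A \ J).ncard := by
    refine Finset.sum_le_sum fun A hA => ?_
    have h1 := hkey A hA
    have h2 := Set.ncard_inter_add_ncard_sdiff_eq_ncard A J
    rw [Set.inter_comm] at h2
    omega
  have h1 := Set.ncard_inter_add_ncard_sdiff_eq_ncard I J
  have h2 := Set.ncard_inter_add_ncard_sdiff_eq_ncard J I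
  rw [Set.inter_comm] at h2
  omega

/-- The matroid `M_f` induced by a monotone submodular function `f`. -/
def inducedMatroid {E : Type*} [Finite E] (f : MonotoneSubmodular E) : Matroid E :=
  (IndepMatroid.ofFinite (Set.toFinite Set.univ) (InducedIndep f)
    (fun I hI hne => absurd hne (by simp [Set.subset_empty_iff.1 hI]))
    (fun _ _ hJ hIJ K hK hne => hJ K (hK.trans hIJ) hne)
    (fun _ _ hI hJ hlt => InducedIndep.exists_insert f hI hJ hlt)
    (fun _ _ => Set.subset_univ _)).matroid

/-- The rank of `F` in a matroid on a finite set, as an integer. -/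
noncomputable def matroidRank {E : Type*} (M : Matroid E) (F : Set E) : ℤ :=
  ((M.eRk F).toNat : ℤ)

theorem matroidRank_mono {E : Type*} [Finite E] (M : Matroid E) (A B : Set E) (h : A ⊆ B) :
    matroidRank M A ≤ matroidRank M B := by
  have hB : M.eRk B ≠ ⊤ := ne_top_of_le_ne_top
    (Set.encard_ne_top_iff.2 (Set.toFinite B)) (M.eRk_le_encard B)
  have h1 := ENat.toNat_le_toNat (M.eRk_mono h) hB
  simp only [matroidRank]
  exact_mod_cast h1

theorem matroidRank_submod {E : Type*} [Finite E] (M : Matroid E) (A B : Set E) :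
    matroidRank M (A ∪ B) + matroidRank M (A ∩ B) ≤ matroidRank M A + matroidRank M B := by
  have hf : ∀ S : Set E, M.eRk S ≠ ⊤ := fun S => ne_top_of_le_ne_top
    (Set.encard_ne_top_iff.2 (Set.toFinite S)) (M.eRk_le_encard S)
  have h := M.eRk_submod A B
  have h := ENat.toNat_le_toNat h (by simp [hf])
  rw [ENat.toNat_add (hf _) (hf _), ENat.toNat_add (hf _) (hf _)] at h
  simp only [matroidRank]
  exact_mod_cast (add_comm _ _).trans_le h

/-- The weak order: every independent set of `N₁` is independent in `N₂`. -/
def WeakLE {E : Type*} (N₁ N₂ : Matroid E) : Prop :=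
  N₁.E = N₂.E ∧ ∀ I, N₁.Indep I → N₂.Indep I

/-- The strict weak order. -/
def WeakLT {E : Type*} (N₁ N₂ : Matroid E) : Prop :=
  WeakLE N₁ N₂ ∧ N₁ ≠ N₂

/-! ### Count matroids -/

/-- The set `V(F)` of vertices that are incident to an edge of `F`. -/
def edgeSupport {V : Type*} (G : SimpleGraph V) (F : Set G.edgeSet) : Set V :=
  {v | ∃ e ∈ F, v ∈ (e : Sym2 V)}

/-- The function `c_{k,l}(F) = k |V(F)| - l`. -/
noncomputable def countFunction {V : Type*} [Finite V] (G : SimpleGraph V) (k l : ℕ) :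
    MonotoneSubmodular G.edgeSet where
  toFun F := k * (edgeSupport G F).ncard - l
  mono A B h := by
    have : (edgeSupport G A).ncard ≤ (edgeSupport G B).ncard :=
      Set.ncard_le_ncard (fun v ⟨e, he, hv⟩ => ⟨e, h he, hv⟩)
    gcongr
  submod A B := by
    have h1 : edgeSupport G (A ∪ B) = edgeSupport G A ∪ edgeSupport G B := by
      ext v; simp only [edgeSupport, Set.mem_ofPred_eq, Set.mem_union]; grind
    have h2 : (edgeSupport G (A ∩ B)).ncard ≤ (edgeSupport G A ∩ edgeSupport G B).ncard :=
      Set.ncard_le_ncard (fun v ⟨e, he, hv⟩ => ⟨⟨e, he.1, hv⟩, ⟨e, he.2, hv⟩⟩)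
    have h3 := Set.ncard_union_add_ncard_inter (edgeSupport G A) (edgeSupport G B)
    rw [← h1] at h3
    have h4 : (edgeSupport G (A ∪ B)).ncard + (edgeSupport G (A ∩ B)).ncard ≤
      (edgeSupport G A).ncard + (edgeSupport G B).ncard := by omega
    have h5 : (k : ℤ) * ((edgeSupport G (A ∪ B)).ncard + (edgeSupport G (A ∩ B)).ncard) ≤
      k * ((edgeSupport G A).ncard + (edgeSupport G B).ncard) :=
      mul_le_mul_of_nonneg_left (by exact_mod_cast h4) (Int.natCast_nonneg k)
    linarith

/-- The `(k,l)`-count matroid of `G`, on the edge set of `G`. It is the graphic matroid for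
`(k,l) = (1,1)` and the bicircular matroid for `(k,l) = (1,0)`. -/
noncomputable def countMatroid {V : Type*} [Finite V] (G : SimpleGraph V) (k l : ℕ) :
    Matroid G.edgeSet :=
  inducedMatroid (countFunction G k l)

/-! ### Hadamard products and algebraic matroids -/

/-- Closure in the Zariski topology of `ℂ^ι`. -/
def zariskiClosure {ι : Type*} (S : Set (ι → ℂ)) : Set (ι → ℂ) :=
  zeroLocus ℂ (vanishingIdeal ℂ S)

/-- `V` is Zariski closed and irreducible. -/
def IsIrreducibleVariety {ι : Type*} (V : Set (ι → ℂ)) : Prop :=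
  zariskiClosure V = V ∧ (vanishingIdeal ℂ V).IsPrime

theorem vanishingIdeal_zariskiClosure {ι : Type*} (S : Set (ι → ℂ)) :
    vanishingIdeal ℂ (zariskiClosure S) = vanishingIdeal ℂ S :=
  le_antisymm (vanishingIdeal_anti_mono (zeroLocus_vanishingIdeal_le S))
    (le_vanishingIdeal_zeroLocus _)

theorem zariskiClosure_eq_univ_iff {ι : Type*} (S : Set (ι → ℂ)) :
    zariskiClosure S = Set.univ ↔ ∀ p : MvPolynomial ι ℂ, (∀ x ∈ S, aeval x p = 0) → p = 0 := by
  constructor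
  · intro h p hp
    have h1 : p ∈ vanishingIdeal ℂ (zariskiClosure S) := by
      rw [vanishingIdeal_zariskiClosure]; exact hp
    rw [h] at h1
    refine MvPolynomial.funext fun x => ?_
    have := h1 x (Set.mem_univ x)
    rw [map_zero]
    rwa [aeval_eq_eval] at this
  · intro h
    refine Set.eq_univ_of_forall fun x p hp => ?_
    rw [h p hp, map_zero]

/-- `I` belongs to `I_V` if the coordinate projection of `V` to `ℂ^I` is Zariski dense. -/
def AlgIndep {ι : Type*} (V : Set (ι → ℂ)) (I : Set ι) : Prop :=
  zariskiClosure ((fun x : ι → ℂ => I.domRestrict x) '' V) = Set.univ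

theorem exists_algebraicMatroid {ι : Type*} (V : Set (ι → ℂ)) (hV : IsIrreducibleVariety V) :
    ∃ M : Matroid ι, Set.univ = M.E ∧ ∀ I, M.Indep I ↔ AlgIndep V I := by
  have := hV.2
  let A := MvPolynomial ι ℂ ⧸ vanishingIdeal ℂ V
  have hdom : IsDomain A := Ideal.Quotient.isDomain _
  have hinj : FaithfulSMul ℂ A :=
    (faithfulSMul_iff_algebraMap_injective ℂ A).2 (algebraMap ℂ A).injective
  let c : ι → A := fun i => Ideal.Quotient.mk _ (X i)
  refine ⟨(AlgebraicIndependent.matroid ℂ A).comap c, by simp, fun I => ?_⟩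
  have h1 : (AlgebraicIndepOn ℂ id (c '' I) ∧ Set.InjOn c I) ↔
      AlgebraicIndependent ℂ (fun i : I => c i) := by
    constructor
    · rintro ⟨h, hinj⟩
      exact (h.comp (fun i : I => (⟨c i, i, i.2, rfl⟩ : c '' I))
        (fun i j hij => Subtype.ext (hinj i.2 j.2 (congrArg Subtype.val hij))) :)
    · intro h
      have hinj : Set.InjOn c I := fun i hi j hj hij =>
        congrArg Subtype.val (h.injective (a₁ := ⟨i, hi⟩) (a₂ := ⟨j, hj⟩) hij)
      refine ⟨?_, hinj⟩
      have := h.coe_range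
      rw [← Set.image_eq_range] at this
      exact this
  rw [Matroid.comap_indep_iff, AlgebraicIndependent.matroid_indep_iff, h1, AlgIndep,
    zariskiClosure_eq_univ_iff, algebraicIndependent_iff]
  refine forall_congr' fun p => imp_congr ?_ Iff.rfl
  have h2 : aeval (fun i : I => c i) p =
      Ideal.Quotient.mk (vanishingIdeal ℂ V) (rename (fun i : I => (i : ι)) p) := by
    have : aeval (fun i : I => c i) =
        (Ideal.Quotient.mkₐ ℂ (vanishingIdeal ℂ V)).comp (rename (fun i : I => (i : ι))) := by
      ext i; simp [c]
    rw [this]; rfl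
  rw [h2, Ideal.Quotient.eq_zero_iff_mem, mem_vanishingIdeal_iff]
  simp only [Set.forall_mem_image, aeval_rename]
  rfl

/-- The algebraic matroid `M(V)` of an irreducible variety `V`. -/
noncomputable def algebraicMatroid {ι : Type*} (V : Set (ι → ℂ)) (hV : IsIrreducibleVariety V) :
    Matroid ι :=
  Matroid.ofExistsMatroid Set.univ (AlgIndep V) (exists_algebraicMatroid V hV)

/-- The Hadamard product `X₁ * ⋯ * X_d`: the Zariski closure of the set of coordinatewise
products. -/
def hadamardProduct {ι : Type*} {d : ℕ} (X : Fin d → Set (ι → ℂ)) : Set (ι → ℂ) :=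
  zariskiClosure {z | ∃ x : Fin d → ι → ℂ, (∀ i, x i ∈ X i) ∧ z = fun j => ∏ i, x i j}

/-- A nonempty set whose points are joined within the set by polynomial curves has prime
vanishing ideal. -/
theorem isPrime_vanishingIdeal_of_curves {ι : Type*} (S : Set (ι → ℂ)) (hne : S.Nonempty)
    (h : ∀ x ∈ S, ∀ y ∈ S, ∃ γ : ι → Polynomial ℂ,
      (∀ t : ℂ, (fun i => (γ i).eval t) ∈ S) ∧ (∀ i, (γ i).eval 0 = x i) ∧
        (∀ i, (γ i).eval 1 = y i)) :
    (vanishingIdeal ℂ S).IsPrime := by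
  refine ⟨?_, ?_⟩
  · intro htop
    obtain ⟨x, hx⟩ := hne
    have h1 : (1 : MvPolynomial ι ℂ) ∈ vanishingIdeal ℂ S := by rw [htop]; trivial
    simpa using h1 x hx
  · intro p q hpq
    by_contra hcon
    push Not at hcon
    obtain ⟨hp, hq⟩ := hcon
    simp only [mem_vanishingIdeal_iff, not_forall] at hp hq
    obtain ⟨x, hx, hpx⟩ := hp
    obtain ⟨y, hy, hqy⟩ := hq
    obtain ⟨γ, hγ, h0, h1⟩ := h x hx y hy
    have key : ∀ (r : MvPolynomial ι ℂ) (t : ℂ),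
        (aeval γ r).eval t = aeval (fun i => (γ i).eval t) r := by
      intro r t
      have : (Polynomial.aeval t).comp (aeval γ) =
          (aeval (fun i => (γ i).eval t) : MvPolynomial ι ℂ →ₐ[ℂ] ℂ) := by
        ext i; simp [Polynomial.aeval_def, Polynomial.eval₂_eq_eval_map]
      have := DFunLike.congr_fun this r
      simpa using this
    have hz : aeval γ p * aeval γ q = 0 := by
      refine Polynomial.funext fun t => ?_
      rw [← map_mul, key, Polynomial.eval_zero]
      exact hpq _ (hγ t)
    rcases mul_eq_zero.1 hz with hz | hz
    · apply hpx
      have := key p 0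
      rw [hz, Polynomial.eval_zero, funext h0] at this
      exact this.symm
    · apply hqy
      have := key q 1
      rw [hz, Polynomial.eval_zero, funext h1] at this
      exact this.symm

theorem isIrreducibleVariety_hadamardProduct {ι : Type*} {d : ℕ}
    (L : Fin d → Submodule ℂ (ι → ℂ)) :
    IsIrreducibleVariety (hadamardProduct (fun i => (L i : Set (ι → ℂ)))) := by
  refine ⟨?_, ?_⟩
  · rw [hadamardProduct]
    conv_lhs => rw [zariskiClosure, vanishingIdeal_zariskiClosure]
    rfl
  · rw [hadamardProduct, vanishingIdeal_zariskiClosure]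
    refine isPrime_vanishingIdeal_of_curves _ ⟨_, fun _ => 0, fun i => (L i).zero_mem, rfl⟩ ?_
    rintro _ ⟨x, hx, rfl⟩ _ ⟨y, hy, rfl⟩
    refine ⟨fun j => ∏ i, (Polynomial.C (x i j) +
      Polynomial.X * Polynomial.C (y i j - x i j)), fun t => ?_, fun j => ?_, fun j => ?_⟩
    · refine ⟨fun i => x i + t • (y i - x i), fun i => ?_, ?_⟩
      · exact (L i).add_mem (hx i) ((L i).smul_mem _ ((L i).sub_mem (hy i) (hx i)))
      · funext j
        simp [Polynomial.eval_prod]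
    · simp [Polynomial.eval_prod]
    · simp [Polynomial.eval_prod]

theorem isIrreducibleVariety_submodule {ι : Type*} [Finite ι] (L : Submodule ℂ (ι → ℂ)) :
    IsIrreducibleVariety (L : Set (ι → ℂ)) := by
  classical
  obtain ⟨_⟩ := nonempty_fintype ι
  refine ⟨Set.Subset.antisymm ?_ (zeroLocus_vanishingIdeal_le _), ?_⟩
  · intro x hx
    by_contra hxL
    obtain ⟨φ, hφ, hL⟩ := Submodule.exists_le_ker_of_notMem (p := L) hxL
    let p : MvPolynomial ι ℂ := ∑ i, C (φ (Pi.single i 1)) * X i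
    have hp : ∀ y : ι → ℂ, aeval y p = φ y := by
      intro y
      have h1 := LinearMap.pi_apply_eq_sum_univ φ y
      simp only [smul_eq_mul] at h1
      simp only [p, map_sum, map_mul, aeval_X, algHom_C]
      rw [h1]
      refine Finset.sum_congr rfl fun i _ => ?_
      rw [mul_comm]
      congr 1
      change φ _ = φ _
      congr 1
      funext j
      simp [Pi.single_apply, eq_comm]
    refine hφ ?_
    rw [← hp]
    exact hx p (fun y hy => by rw [hp]; exact hL hy)
  · refine isPrime_vanishingIdeal_of_curves _ ⟨0, L.zero_mem⟩ fun x hx y hy => ?_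
    refine ⟨fun j => Polynomial.C (x j) + Polynomial.X * Polynomial.C (y j - x j),
      fun t => ?_, fun j => by simp, fun j => by simp⟩
    have : (fun j => (Polynomial.C (x j) +
        Polynomial.X * Polynomial.C (y j - x j)).eval t) = x + t • (y - x) := by
      funext j; simp
    rw [this]
    exact L.add_mem hx (L.smul_mem _ (L.sub_mem hy hx))

/-- The algebraic matroid `M(L)` of a linear space `L`. -/
noncomputable def linearSpaceMatroid {ι : Type*} [Finite ι] (L : Submodule ℂ (ι → ℂ)) :
    Matroid ι :=
  algebraicMatroid (L : Set (ι → ℂ)) (isIrreducibleVariety_submodule L)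

/-- The algebraic matroid `M(L₁ * ⋯ * L_d)` of a Hadamard product of linear spaces. -/
noncomputable def hadamardMatroid {ι : Type*} {d : ℕ} (L : Fin d → Submodule ℂ (ι → ℂ)) :
    Matroid ι :=
  algebraicMatroid (hadamardProduct (fun i => (L i : Set (ι → ℂ))))
    (isIrreducibleVariety_hadamardProduct L)

/-- The function `r₁ + ⋯ + r_d - (d - 1)`, where `r_i` is the rank function of `M(L_i)`. -/
noncomputable def bernsteinFunction {ι : Type*} [Finite ι] {d : ℕ}
    (L : Fin d → Submodule ℂ (ι → ℂ)) : MonotoneSubmodular ι where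
  toFun F := ∑ i, matroidRank (linearSpaceMatroid (L i)) F - ((d : ℤ) - 1)
  mono A B h := by
    have := Finset.sum_le_sum (s := Finset.univ)
      (fun i _ => matroidRank_mono (linearSpaceMatroid (L i)) A B h)
    linarith
  submod A B := by
    have := Finset.sum_le_sum (s := Finset.univ)
      (fun i _ => matroidRank_submod (linearSpaceMatroid (L i)) A B)
    rw [Finset.sum_add_distrib, Finset.sum_add_distrib] at this
    linarith

/-- The matrix `A` represents `N` as a row matroid. -/
def RepresentsRows {E : Type*} {n : ℕ} (A : Matrix E (Fin n) ℂ) (N : Matroid E) : Prop :=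
  N.E = Set.univ ∧ ∀ I : Set E, N.Indep I ↔ LinearIndependent ℂ (fun e : I => A.row e)

/-- The column space of a matrix. -/
def columnSpace {E : Type*} {n : ℕ} (A : Matrix E (Fin n) ℂ) : Submodule ℂ (E → ℂ) :=
  Submodule.span ℂ (Set.range A.col)

/-! ### The graph -/

/-- A cyclic chain of four copies of `K₆` minus an edge. The vertices `(i, 0)` are four hubs. For
each `i` (mod 4) the six vertices `(i, 0), …, (i, 4), (i + 1, 0)` span a `K₆` minus the edge
joining the two hubs `(i, 0)` and `(i + 1, 0)`; there are no other edges. -/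
def hubGraph : SimpleGraph (Fin 4 × Fin 5) where
  Adj p q := (p.1 = q.1 ∧ p.2 ≠ q.2) ∨ (q.1 = p.1 + 1 ∧ p.2 ≠ 0 ∧ q.2 = 0) ∨
    (p.1 = q.1 + 1 ∧ q.2 ≠ 0 ∧ p.2 = 0)
  symm := ⟨fun p q h => by
    rcases h with h | h | h
    · exact Or.inl ⟨h.1.symm, h.2.symm⟩
    · exact Or.inr (Or.inr h)
    · exact Or.inr (Or.inl h)⟩
  loopless := ⟨fun p h => by
    rcases h with h | h | h
    · exact h.2 rfl
    · exact h.2.1 h.2.2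
    · exact h.2.1 h.2.2⟩

/-!
A Hadamard product of linear spaces does not change when each factor is rescaled by a nonzero
constant and one common scalar is put back. So on a set of coordinates it has dimension at most
`1 + ∑ i, (r i - 1)`, which is the bound of Bernstein's conjecture. On the graph of the theorem this
is `1 + 18 + 18 + 19 = 56`, the number of edges, and it is attained by the function of the
conjecture: on a connected set of edges the ranks of the count matroids add up as required, and they
are superadditive over vertex-disjoint unions.

A factor may also be rescaled separately on each block of a partition of the coordinates, with one
scalar put back per block. Each graphic factor has rank `5` on each of the four blocks, so it then
costs `4 · (5 - 1) = 16` instead of `18`, while three more scalars are needed. The dimension is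
therefore at most `4 + 16 + 16 + 19 = 55 < 56`.
-/

/-! ### Independence and rank -/

theorem inducedMatroid_indep_iff {E : Type*} [Finite E] (f : MonotoneSubmodular E) (F : Set E) :
    (inducedMatroid f).Indep F ↔ InducedIndep f F := by
  rw [inducedMatroid, IndepMatroid.matroid_indep_iff]
  exact iff_of_eq (congrFun (IndepMatroid.ofFinite_indep _ _ _ _ _ _) F)

theorem countMatroid_indep_iff {V : Type*} [Finite V] (G : SimpleGraph V) (k l : ℕ)
    (F : Set G.edgeSet) :
    (countMatroid G k l).Indep F ↔ ∀ I ⊆ F, I.Nonempty →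
      (I.ncard : ℤ) ≤ k * (edgeSupport G I).ncard - l :=
  inducedMatroid_indep_iff _ F

section Rank

variable {E : Type*} {M : Matroid E} {I X : Set E}

theorem exists_indep_ncard_eq_matroidRank (M : Matroid E) (X : Set E) :
    ∃ I ⊆ X, M.Indep I ∧ (I.ncard : ℤ) = matroidRank M X := by
  obtain ⟨I, hI⟩ := M.exists_isBasis' X
  refine ⟨I, hI.subset, hI.indep, ?_⟩
  rw [matroidRank, ← hI.encard_eq_eRk]
  rfl

theorem ncard_le_matroidRank_of_indep [Finite E] (hI : M.Indep I) (hIX : I ⊆ X) :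
    (I.ncard : ℤ) ≤ matroidRank M X := by
  have hX : M.eRk X ≠ ⊤ := ne_top_of_le_ne_top X.toFinite.encard_lt_top.ne (M.eRk_le_encard X)
  exact Int.ofNat_le.2 (ENat.toNat_le_toNat (hI.encard_le_eRk_of_subset hIX) hX)

theorem matroidRank_eq_ncard_of_indep (hI : M.Indep I) : matroidRank M I = I.ncard := by
  rw [matroidRank, hI.eRk_eq_encard]
  rfl

theorem matroidRank_lt_ncard_of_not_indep [Finite E] (hX : ¬ M.Indep X) :
    matroidRank M X < X.ncard := by
  obtain ⟨I, hIX, hI, hcard⟩ := exists_indep_ncard_eq_matroidRank M X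
  rw [← hcard, Int.ofNat_lt]
  exact Set.ncard_lt_ncard (hIX.ssubset_of_ne fun h => hX (h ▸ hI))

end Rank

/-! ### Algebraic matroids of linear spaces -/

theorem algebraicMatroid_indep_iff {ι : Type*} (V : Set (ι → ℂ)) (hV : IsIrreducibleVariety V)
    (I : Set ι) : (algebraicMatroid V hV).Indep I ↔ AlgIndep V I := by
  simp [algebraicMatroid, Matroid.ofExistsMatroid]

theorem algIndep_iff {ι : Type*} (V : Set (ι → ℂ)) (I : Set ι) :
    AlgIndep V I ↔ ∀ p : MvPolynomial I ℂ, (∀ x ∈ V, aeval (fun i : I => x i) p = 0) → p = 0 := by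
  rw [AlgIndep, zariskiClosure_eq_univ_iff]
  refine forall_congr' fun p => ?_
  rw [Set.forall_mem_image]
  rfl

theorem algIndep_zariskiClosure {ι : Type*} (S : Set (ι → ℂ)) (I : Set ι) :
    AlgIndep (zariskiClosure S) I ↔ AlgIndep S I := by
  have mem_iff (V : Set (ι → ℂ)) (p : MvPolynomial I ℂ) :
      (∀ x ∈ V, aeval (fun i : I => x i) p = 0) ↔ rename Subtype.val p ∈ vanishingIdeal ℂ V := by
    simp only [mem_vanishingIdeal_iff, aeval_rename]
    rfl
  simp only [algIndep_iff, mem_iff, vanishingIdeal_zariskiClosure]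

theorem surjective_pi_of_linearIndependent {K M κ : Type*} [Field K] [AddCommGroup M] [Module K M]
    [Finite κ] {f : κ → M →ₗ[K] K} (hf : LinearIndependent K f) :
    Function.Surjective (LinearMap.pi f) := by
  classical
  obtain ⟨_⟩ := nonempty_fintype κ
  refine LinearMap.dualMap_injective_iff.1 ((injective_iff_map_eq_zero _).2 fun φ hφ => ?_)
  have hsum : ∑ i, φ (fun j => if i = j then 1 else 0) • f i = 0 := by
    ext x
    have hx : φ (fun i => f i x) = 0 := LinearMap.congr_fun hφ x
    rw [LinearMap.pi_apply_eq_sum_univ] at hx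
    simpa [mul_comm] using hx
  refine LinearMap.ext fun y => ?_
  rw [LinearMap.pi_apply_eq_sum_univ]
  simp [Fintype.linearIndependent_iff.1 hf _ hsum]

/-- The `e`-th coordinate as a linear functional on `L`; a set of coordinates is independent in
`M(L)` exactly when these functionals are linearly independent. -/
def coordFunctional {K ι : Type*} [CommSemiring K] (L : Submodule K (ι → K)) (e : ι) : L →ₗ[K] K :=
  LinearMap.proj e ∘ₗ L.subtype

theorem coordFunctional_apply {K ι : Type*} [CommSemiring K] (L : Submodule K (ι → K)) (e : ι)
    (x : L) : coordFunctional L e x = (x : ι → K) e := rfl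

theorem algIndep_submodule_iff {ι : Type*} [Finite ι] (L : Submodule ℂ (ι → ℂ)) (I : Set ι) :
    AlgIndep (L : Set (ι → ℂ)) I ↔ LinearIndepOn ℂ (coordFunctional L) I := by
  classical
  obtain ⟨_⟩ := nonempty_fintype I
  rw [algIndep_iff]
  constructor
  · intro h
    refine Fintype.linearIndependent_iff.2 fun g hg i => ?_
    have hlin : (∑ j : I, C (g j) * X j : MvPolynomial I ℂ) = 0 := by
      refine h _ fun x hx => ?_
      simpa [coordFunctional_apply] using LinearMap.congr_fun hg ⟨x, hx⟩
    simpa [Pi.single_apply] using congrArg (eval (Pi.single i (1 : ℂ))) hlin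
  · intro h p hp
    refine MvPolynomial.funext fun y => ?_
    obtain ⟨x, rfl⟩ := surjective_pi_of_linearIndependent h y
    rw [map_zero, ← aeval_eq_eval]
    exact hp x x.2

theorem linearSpaceMatroid_indep_iff {ι : Type*} [Finite ι] (L : Submodule ℂ (ι → ℂ))
    (I : Set ι) : (linearSpaceMatroid L).Indep I ↔ LinearIndepOn ℂ (coordFunctional L) I := by
  rw [linearSpaceMatroid, algebraicMatroid_indep_iff, algIndep_submodule_iff]

theorem linearSpaceMatroid_indep_singleton_iff {ι : Type*} [Finite ι] (L : Submodule ℂ (ι → ℂ))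
    (e : ι) : (linearSpaceMatroid L).Indep {e} ↔ ∃ x ∈ L, x e ≠ 0 := by
  rw [linearSpaceMatroid_indep_iff, linearIndepOn_singleton_iff, Ne, LinearMap.ext_iff, not_forall]
  simp [coordFunctional_apply]

theorem linearIndependent_rows_iff_coordFunctional {E : Type*} {n : ℕ}
    (A : Matrix E (Fin n) ℂ) (I : Set E) :
    LinearIndependent ℂ (fun e : I => A.row e) ↔
      LinearIndepOn ℂ (coordFunctional (columnSpace A)) I := by
  let ev : (columnSpace A →ₗ[ℂ] ℂ) →ₗ[ℂ] (Fin n → ℂ) := LinearMap.pi fun k =>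
    LinearMap.applyₗ ⟨A.col k, Submodule.subset_span ⟨k, rfl⟩⟩
  have hker : LinearMap.ker ev = ⊥ := by
    refine LinearMap.ker_eq_bot'.2 fun f hf => ?_
    refine LinearMap.ext_on Submodule.span_span_coe_preimage ?_
    rintro ⟨_, -⟩ ⟨k, rfl⟩
    exact congrFun hf k
  exact LinearMap.linearIndependent_iff (v := fun e : I => coordFunctional (columnSpace A) e)
    ev hker

theorem RepresentsRows.linearSpaceMatroid_columnSpace {E : Type*} [Finite E] {n : ℕ}
    {A : Matrix E (Fin n) ℂ} {N : Matroid E} (h : RepresentsRows A N) :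
    linearSpaceMatroid (columnSpace A) = N := by
  refine Matroid.ext_indep h.1.symm fun I _ => ?_
  rw [h.2, linearSpaceMatroid_indep_iff, linearIndependent_rows_iff_coordFunctional]

/-! ### Dimension bounds for Hadamard products -/

theorem exists_ne_zero_aeval_eq_zero_of_card_lt {σ κ : Type*} [Finite σ]
    (h : Nat.card σ < Nat.card κ) (φ : κ → MvPolynomial σ ℂ) :
    ∃ p : MvPolynomial κ ℂ, p ≠ 0 ∧ aeval φ p = 0 := by
  by_contra! hcon
  have : Finite κ := Nat.finite_of_card_ne_zero (by omega)
  have hφ : AlgebraicIndependent ℂ φ :=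
    algebraicIndependent_iff.2 fun p hp => by_contra fun h0 => hcon p h0 hp
  have htrdeg := hφ.lift_cardinalMk_le_trdeg
  rw [MvPolynomial.trdeg_of_isDomain, ← Nat.cast_card, ← Nat.cast_card] at htrdeg
  simp only [Cardinal.lift_natCast, Nat.cast_le] at htrdeg
  omega

theorem AlgIndep.ncard_le_of_parametrization {ι σ : Type*} [Finite σ] {S : Set (ι → ℂ)}
    {J : Set ι} (hJ : AlgIndep S J) (φ : J → MvPolynomial σ ℂ) {q : MvPolynomial J ℂ} (hq : q ≠ 0)
    (hφ : ∀ x ∈ S, aeval (fun j : J => x j) q ≠ 0 → ∃ t, ∀ j : J, x j = eval t (φ j)) :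
    J.ncard ≤ Nat.card σ := by
  by_contra! hlt
  obtain ⟨p, hp, hpφ⟩ := exists_ne_zero_aeval_eq_zero_of_card_lt hlt φ
  refine mul_ne_zero hp hq ((algIndep_iff S J).1 hJ _ fun x hx => ?_)
  rw [map_mul, mul_eq_zero, or_iff_not_imp_right]
  intro hqx
  obtain ⟨t, ht⟩ := hφ x hx hqx
  have hcomp : (aeval t : MvPolynomial σ ℂ →ₐ[ℂ] ℂ).comp (aeval φ) =
      aeval fun j : J => x j := by
    ext j
    simp [ht j, aeval_eq_eval]
  rw [← hcomp, AlgHom.comp_apply, hpφ, map_zero]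

/-- If a point of `L` is rescaled to have `e`-th coordinate `1`, then its coordinates in `J` are
affine functions of `r(J) - 1` among them. -/
theorem exists_affine_parametrization {ι : Type*} [Finite ι] (L : Submodule ℂ (ι → ℂ))
    {J : Set ι} {e : ι} (he : e ∈ J) (hL : ∃ x ∈ L, x e ≠ 0) :
    ∃ (s : Finset ι) (φ : ι → MvPolynomial s ℂ),
      (s.card : ℤ) ≤ matroidRank (linearSpaceMatroid L) J - 1 ∧
      ∀ x ∈ L, x e ≠ 0 → ∃ t : s → ℂ, ∀ j ∈ J, x j = x e * eval t (φ j) := by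
  classical
  rw [← linearSpaceMatroid_indep_singleton_iff, linearSpaceMatroid_indep_iff] at hL
  obtain ⟨B, hBJ, heB, hspan, hB⟩ :=
    exists_linearIndepOn_extension hL (Set.singleton_subset_iff.2 he)
  obtain ⟨B, rfl⟩ := B.toFinite.exists_finset_coe
  replace heB : e ∈ B := heB rfl
  have hcoord (j : ι) : ∃ c : ι → ℂ, j ∈ J →
      coordFunctional L j = ∑ k ∈ B, c k • coordFunctional L k := by
    by_cases hj : j ∈ J
    · obtain ⟨c, hc⟩ := (Submodule.mem_span_image_finset_iff_exists_fun ℂ).1 (hspan ⟨j, hj, rfl⟩)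
      refine ⟨fun k => if h : k ∈ B then c ⟨k, h⟩ else 0, fun _ => ?_⟩
      simp [← hc, ← Finset.sum_coe_sort B]
    · exact ⟨0, fun h => absurd h hj⟩
  choose c hc using hcoord
  refine ⟨B.erase e, fun j => C (c j e) + ∑ k : B.erase e, C (c j k) * X k, ?_,
    fun x hx hxe => ⟨fun k => x k / x e, fun j hj => ?_⟩⟩
  · have hrank := ncard_le_matroidRank_of_indep ((linearSpaceMatroid_indep_iff L _).2 hB) hBJ
    rw [Set.ncard_coe_finset, ← Finset.card_erase_add_one heB] at hrank
    push_cast at hrank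
    linarith
  · have hxj : x j = ∑ k ∈ B, c j k * x k := by
      simpa [coordFunctional_apply] using LinearMap.congr_fun (hc j hj) ⟨x, hx⟩
    simp only [map_add, map_sum, map_mul, eval_C, eval_X, mul_add, Finset.mul_sum]
    rw [Finset.sum_coe_sort (B.erase e) fun k => x e * (c j k * (x k / x e)), hxj,
      ← Finset.add_sum_erase B _ heB, mul_comm (c j e)]
    congr 1
    refine Finset.sum_congr rfl fun k _ => ?_
    field_simp

theorem algIndep_hadamardProduct_iff {ι : Type*} {d : ℕ} (Y : Fin d → Set (ι → ℂ)) (J : Set ι) :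
    AlgIndep (hadamardProduct Y) J ↔
      AlgIndep {z | ∃ x : Fin d → ι → ℂ, (∀ i, x i ∈ Y i) ∧ z = fun j => ∏ i, x i j} J :=
  algIndep_zariskiClosure _ J

theorem exists_ne_zero_of_algIndep_hadamardProduct {ι : Type*} {d : ℕ} {Y : Fin d → Set (ι → ℂ)}
    {J : Set ι} (hJ : AlgIndep (hadamardProduct Y) J) {e : ι} (he : e ∈ J) (i : Fin d) :
    ∃ x ∈ Y i, x e ≠ 0 := by
  by_contra! hcon
  rw [algIndep_hadamardProduct_iff, algIndep_iff] at hJ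
  refine X_ne_zero (R := ℂ) (⟨e, he⟩ : J) (hJ _ ?_)
  rintro _ ⟨x, hx, rfl⟩
  rw [aeval_X]
  exact Finset.prod_eq_zero (Finset.mem_univ i) (hcon _ (hx i))

/-- Each factor is rescaled on each of its blocks separately, so only the projective dimensions of
its projections to the blocks contribute, and one scalar is restored on each common refinement of
the blocks. -/
theorem card_le_of_algIndep_hadamardProduct {ι γ : Type*} [Finite ι] [DecidableEq γ] {d : ℕ}
    {L : Fin d → Submodule ℂ (ι → ℂ)} {J : Finset ι}
    (hJ : AlgIndep (hadamardProduct fun i => (L i : Set (ι → ℂ))) J) (b : ι → Fin d → γ) :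
    (J.card : ℤ) ≤ (J.image b).card + ∑ i, ∑ g ∈ J.image (b · i),
      (matroidRank (linearSpaceMatroid (L i)) {j | j ∈ J ∧ b j i = g} - 1) := by
  classical
  have hrep (i : Fin d) (g : J.image (b · i)) : ∃ e ∈ J, b e i = g := Finset.mem_image.1 g.2
  choose e heJ hbe using hrep
  choose s φ hs hφ using fun i (g : J.image (b · i)) => exists_affine_parametrization (L i)
    (show e i g ∈ {j | j ∈ J ∧ b j i = g} from ⟨heJ i g, hbe i g⟩)
    (exists_ne_zero_of_algIndep_hadamardProduct hJ (heJ i g) i)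
  have hb (j : J) : b j ∈ J.image b := Finset.mem_image_of_mem b j.2
  let blockOf (c : J.image b) (i : Fin d) : J.image (b · i) :=
    ⟨c.1 i, by
      obtain ⟨j, hj, hc⟩ := Finset.mem_image.1 c.2
      exact hc ▸ Finset.mem_image_of_mem (b · i) hj⟩
  let ψ (j : J) : MvPolynomial (J.image b ⊕ Σ i, Σ g, s i g) ℂ :=
    X (Sum.inl ⟨b j, hb j⟩) *
      ∏ i, rename (fun k => Sum.inr ⟨i, blockOf ⟨b j, hb j⟩ i, k⟩) (φ i (blockOf ⟨b j, hb j⟩ i) j)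
  have hq : ∏ i, ∏ g, (X ⟨e i g, heJ i g⟩ : MvPolynomial J ℂ) ≠ 0 :=
    Finset.prod_ne_zero_iff.2 fun i _ => Finset.prod_ne_zero_iff.2 fun g _ => X_ne_zero _
  have hcard := ((algIndep_hadamardProduct_iff _ _).1 hJ).ncard_le_of_parametrization ψ hq ?_
  · simp only [Set.ncard_coe_finset, Nat.card_eq_fintype_card, Fintype.card_sum, Fintype.card_sigma,
      Fintype.card_coe] at hcard
    calc (J.card : ℤ) ≤ (J.image b).card + ∑ i, ∑ g, ((s i g).card : ℤ) := by exact_mod_cast hcard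
      _ ≤ _ := by
          gcongr with i
          rw [← Finset.sum_coe_sort (J.image (b · i))]
          exact Finset.sum_le_sum fun g _ => hs i g
  · rintro _ ⟨x, hx, rfl⟩ hqx
    simp only [map_prod, aeval_X, Finset.prod_ne_zero_iff, Finset.mem_univ, true_imp_iff] at hqx
    choose t ht using fun i g => hφ i g (x i) (hx i) (hqx i g i)
    refine ⟨Sum.elim (fun c => ∏ i, x i (e i (blockOf c i))) fun v => t v.1 v.2.1 v.2.2,
      fun j => ?_⟩
    simp only [ψ, map_mul, map_prod, eval_X, eval_rename, Sum.elim_inl, ← Finset.prod_mul_distrib]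
    exact Finset.prod_congr rfl fun i _ => ht i _ j ⟨j.2, rfl⟩

theorem hadamardMatroid_indep_iff {ι : Type*} {d : ℕ} (L : Fin d → Submodule ℂ (ι → ℂ))
    (J : Set ι) : (hadamardMatroid L).Indep J ↔
      AlgIndep (hadamardProduct fun i => (L i : Set (ι → ℂ))) J :=
  algebraicMatroid_indep_iff _ _ J

/-- A single block gives the bound of Bernstein's conjecture. -/
theorem hadamardMatroid_weakLE_inducedMatroid_bernsteinFunction {ι : Type*} [Finite ι] {d : ℕ}
    (L : Fin d → Submodule ℂ (ι → ℂ)) :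
    WeakLE (hadamardMatroid L) (inducedMatroid (bernsteinFunction L)) := by
  classical
  refine ⟨rfl, fun J hJ => (inducedMatroid_indep_iff _ J).2 fun I hIJ hI => ?_⟩
  have hindep := hJ.subset hIJ
  obtain ⟨I, rfl⟩ := I.toFinite.exists_finset_coe
  rw [hadamardMatroid_indep_iff] at hindep
  have hcard := card_le_of_algIndep_hadamardProduct hindep fun _ _ => ()
  simp only [Finset.image_const (Finset.coe_nonempty.1 hI), Finset.card_singleton,
    and_true, Finset.setOfPred_mem, Finset.sum_sub_distrib, Finset.sum_const, Finset.card_univ,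
    Fintype.card_fin, nsmul_eq_mul] at hcard
  rw [Set.ncard_coe_finset]
  simp only [bernsteinFunction]
  push_cast [one_mul] at hcard
  linarith

/-! ### Edge supports -/

section EdgeSupport

variable {V : Type*} (G : SimpleGraph V)

theorem edgeSupport_mono {A B : Set G.edgeSet} (h : A ⊆ B) : edgeSupport G A ⊆ edgeSupport G B :=
  fun _ ⟨e, he, hv⟩ => ⟨e, h he, hv⟩

theorem edgeSupport_union (A B : Set G.edgeSet) :
    edgeSupport G (A ∪ B) = edgeSupport G A ∪ edgeSupport G B := by
  ext v
  simp only [edgeSupport, Set.mem_union, Set.mem_ofPred_eq, or_and_right, exists_or]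

theorem edgeSupport_singleton (e : G.edgeSet) : edgeSupport G {e} = {v | v ∈ (e : Sym2 V)} := by
  simp [edgeSupport]

theorem exists_ne_and_edge_eq_mk (e : G.edgeSet) : ∃ v w, v ≠ w ∧ (e : Sym2 V) = s(v, w) := by
  obtain ⟨e, he⟩ := e
  induction e using Sym2.ind with
  | _ v w => exact ⟨v, w, G.ne_of_adj he, rfl⟩

theorem ncard_edgeSupport_singleton (e : G.edgeSet) : (edgeSupport G {e}).ncard = 2 := by
  obtain ⟨v, w, hvw, he⟩ := exists_ne_and_edge_eq_mk G e
  have hpair : edgeSupport G {e} = {v, w} := by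
    ext x
    simp [edgeSupport_singleton, he]
  rw [hpair, Set.ncard_pair hvw]

theorem edgeSupport_nonempty {I : Set G.edgeSet} (hI : I.Nonempty) :
    (edgeSupport G I).Nonempty := by
  obtain ⟨e, he⟩ := hI
  obtain ⟨v, w, -, hvw⟩ := exists_ne_and_edge_eq_mk G e
  exact ⟨v, e, he, by simp [hvw]⟩

theorem disjoint_of_disjoint_edgeSupport {A B : Set G.edgeSet}
    (h : Disjoint (edgeSupport G A) (edgeSupport G B)) : Disjoint A B := by
  rw [Set.disjoint_iff_inter_eq_empty] at h ⊢
  contrapose! h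
  exact (edgeSupport_nonempty G h).mono (Set.subset_inter
    (edgeSupport_mono G Set.inter_subset_left) (edgeSupport_mono G Set.inter_subset_right))

variable [Finite V]

theorem two_le_ncard_edgeSupport {I : Set G.edgeSet} (hI : I.Nonempty) :
    2 ≤ (edgeSupport G I).ncard := by
  obtain ⟨e, he⟩ := hI
  rw [← ncard_edgeSupport_singleton G e]
  exact Set.ncard_le_ncard (edgeSupport_mono G (Set.singleton_subset_iff.2 he))

/-- Otherwise every vertex of the support lies on two edges, while an edge has only two ends. -/
theorem exists_mem_unique_edge_of_ncard_lt {I : Set G.edgeSet}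
    (h : I.ncard < (edgeSupport G I).ncard) :
    ∃ v, ∃ e ∈ I, v ∈ (e : Sym2 V) ∧ ∀ e' ∈ I, v ∈ (e' : Sym2 V) → e' = e := by
  classical
  obtain ⟨_⟩ := nonempty_fintype V
  by_contra! hcon
  obtain ⟨I, rfl⟩ := I.toFinite.exists_finset_coe
  obtain ⟨S, hS⟩ := (edgeSupport G I).toFinite.exists_finset_coe
  rw [← hS, Set.ncard_coe_finset, Set.ncard_coe_finset] at h
  have hcount := Finset.card_mul_le_card_mul (s := S) (t := I) (m := 2) (n := 2)
    (fun v (e : G.edgeSet) => v ∈ (e : Sym2 V)) ?_ ?_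
  · omega
  · intro v hv
    obtain ⟨e, he, hve⟩ : v ∈ edgeSupport G I := hS ▸ hv
    obtain ⟨e', he', hve', hne⟩ := hcon v e he hve
    rw [Nat.succ_le_iff, Finset.one_lt_card]
    exact ⟨e', (Finset.mem_bipartiteAbove _).2 ⟨he', hve'⟩, e,
      (Finset.mem_bipartiteAbove _).2 ⟨he, hve⟩, hne⟩
  · intro e _
    rw [← ncard_edgeSupport_singleton G e, ← Set.ncard_coe_finset, edgeSupport_singleton]
    exact Set.ncard_le_ncard fun v hv => ((Finset.mem_bipartiteBelow _).1 hv).2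

end EdgeSupport

/-! ### Representations of the graphic and the bicircular matroid -/

section Independence

variable {K E V : Type*} [Field K] {ρ : E → V → K} {I : Set E}

theorem linearIndepOn_of_exists_pivot
    (h : ∀ S : Finset E, (S : Set E) ⊆ I → S.Nonempty →
      ∃ e ∈ S, ∃ v, ρ e v ≠ 0 ∧ ∀ e' ∈ S, e' ≠ e → ρ e' v = 0) :
    LinearIndepOn K ρ I := by
  classical
  refine linearIndepOn_iff'.2 fun S g hSI hg => ?_
  by_contra! hne
  obtain ⟨e, he, v, hev, hzero⟩ := h {e ∈ S | g e ≠ 0}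
    (fun e he => hSI (Finset.mem_filter.1 he).1) (Finset.filter_nonempty_iff.2 hne)
  rw [Finset.mem_filter] at he
  have hgv : ∑ e' ∈ S, g e' * ρ e' v = 0 := by simpa using congrFun hg v
  rw [Finset.sum_eq_single_of_mem e he.1] at hgv
  · exact mul_ne_zero he.2 hev hgv
  · intro e' he' hne'
    by_cases hge' : g e' = 0
    · rw [hge', zero_mul]
    · rw [hzero e' (Finset.mem_filter.2 ⟨he', hge'⟩) hne', mul_zero]

theorem apply_eq_zero_of_mem_span_image {v : V} (h : ∀ e ∈ I, ρ e v = 0) {x : V → K}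
    (hx : x ∈ Submodule.span K (ρ '' I)) : x v = 0 := by
  have hle : Submodule.span K (ρ '' I) ≤ LinearMap.ker (LinearMap.proj v : (V → K) →ₗ[K] K) :=
    Submodule.span_le.2 (Set.forall_mem_image.2 h)
  exact hle hx

theorem ncard_le_of_linearIndepOn [Finite V] (hρ : LinearIndepOn K ρ I) {T : Set V}
    (h : ∀ x ∈ Submodule.span K (ρ '' I), (∀ v ∈ T, x v = 0) → x = 0) : I.ncard ≤ T.ncard := by
  obtain ⟨_⟩ := nonempty_fintype T
  have hrestrict : LinearIndependent K
      (LinearMap.funLeft K K (Subtype.val : T → V) ∘ fun e : I => ρ e) := by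
    refine LinearIndependent.map hρ (Submodule.disjoint_def.2 fun x hx hxT => ?_)
    rw [← Set.image_eq_range] at hx
    exact h x hx fun v hv => congrFun hxT ⟨v, hv⟩
  have := hrestrict.finite
  obtain ⟨_⟩ := nonempty_fintype I
  simpa [← Nat.card_eq_fintype_card] using hrestrict.fintype_card_le_finrank

theorem ncard_le_of_linearIndepOn_of_support_subset [Finite V] (hρ : LinearIndepOn K ρ I)
    {S : Set V} (hS : ∀ e ∈ I, ∀ v ∉ S, ρ e v = 0) : I.ncard ≤ S.ncard := by
  refine ncard_le_of_linearIndepOn hρ fun x hx hxS => funext fun v => ?_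
  by_cases hv : v ∈ S
  · exact hxS v hv
  · exact apply_eq_zero_of_mem_span_image (fun e he => hS e he v hv) hx

theorem ncard_lt_of_linearIndepOn_of_sum_eq_zero [Fintype V] (hρ : LinearIndepOn K ρ I)
    (hsum : ∀ e ∈ I, ∑ v, ρ e v = 0) {S : Set V} (hS : ∀ e ∈ I, ∀ v ∉ S, ρ e v = 0)
    (hne : S.Nonempty) : I.ncard < S.ncard := by
  obtain ⟨v₀, hv₀⟩ := hne
  refine lt_of_le_of_lt (ncard_le_of_linearIndepOn hρ (T := S \ {v₀}) fun x hx hxS => ?_)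
    (Set.ncard_sdiff_singleton_lt_of_mem hv₀)
  have hx_of_ne (v : V) (hv : v ≠ v₀) : x v = 0 := by
    by_cases hvS : v ∈ S
    · exact hxS v ⟨hvS, hv⟩
    · exact apply_eq_zero_of_mem_span_image (fun e he => hS e he v hvS) hx
  have hle : Submodule.span K (ρ '' I) ≤
      LinearMap.ker (∑ v, LinearMap.proj v : (V → K) →ₗ[K] K) :=
    Submodule.span_le.2 (Set.forall_mem_image.2 fun e he => by simp [hsum e he])
  have hx₀ : ∑ v, x v = 0 := by simpa using hle hx
  rw [Finset.sum_eq_single v₀ (fun v _ => hx_of_ne v) (by simp)] at hx₀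
  funext v
  by_cases hv : v = v₀
  exacts [hv ▸ hx₀, hx_of_ne v hv]

end Independence

theorem exists_representsRows_of_vectors {E V : Type*} [Finite V] {N : Matroid E}
    (hN : N.E = Set.univ) {ρ : E → V → ℂ} (h : ∀ I, N.Indep I ↔ LinearIndepOn ℂ ρ I) :
    ∃ (n : ℕ) (A : Matrix E (Fin n) ℂ), RepresentsRows A N := by
  refine ⟨Nat.card V, fun e k => ρ e ((Finite.equivFin V).symm k), hN, fun I => ?_⟩
  rw [h]
  exact (LinearMap.linearIndependent_iff (LinearEquiv.funCongrLeft ℂ ℂ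
    (Finite.equivFin V).symm).toLinearMap (LinearEquiv.ker _)).symm

/-- The vectors are the rows of the oriented incidence matrix. A forest has a leaf, which serves as
a pivot, and all the rows lie in the hyperplane of coordinate sum `0`. -/
theorem exists_vectors_graphic (K : Type*) [Field K] {V : Type*} [Finite V] (G : SimpleGraph V) :
    ∃ ρ : G.edgeSet → V → K, ∀ F, (countMatroid G 1 1).Indep F ↔ LinearIndepOn K ρ F := by
  classical
  obtain ⟨_⟩ := nonempty_fintype V
  choose v w hvw he using exists_ne_and_edge_eq_mk G
  let ρ (e : G.edgeSet) : V → K := Pi.single (v e) 1 - Pi.single (w e) 1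
  have hρ (e : G.edgeSet) (x : V) : ρ e x ≠ 0 ↔ x ∈ (e : Sym2 V) := by
    rw [he, Sym2.mem_iff]
    by_cases hxv : x = v e
    · subst hxv
      simp [ρ, hvw e]
    · simp [ρ, Pi.single_apply, hxv]
  refine ⟨ρ, fun F => ?_⟩
  rw [countMatroid_indep_iff]
  refine ⟨fun hF => linearIndepOn_of_exists_pivot fun S hSF hS => ?_, fun hF I hIF hI => ?_⟩
  · have hcard := hF S hSF hS
    obtain ⟨x, e, heS, hxe, huniq⟩ := exists_mem_unique_edge_of_ncard_lt G
      (show (S : Set G.edgeSet).ncard < (edgeSupport G S).ncard by push_cast at hcard; omega)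
    exact ⟨e, heS, x, (hρ e x).2 hxe, fun e' he' hne =>
      not_not.1 fun h => hne (huniq e' he' ((hρ e' x).1 h))⟩
  · have hcard := ncard_lt_of_linearIndepOn_of_sum_eq_zero (hF.mono hIF)
      (fun e _ => by simp [ρ])
      (fun e he x (hx : x ∉ edgeSupport G I) => not_not.1 fun h =>
        hx ⟨e, he, (hρ e x).1 h⟩) (edgeSupport_nonempty G hI)
    push_cast
    omega

/-- The matrix with support `r` whose nonzero entries are independent variables; its substitutions
by generic scalars represent the transversal matroid of `r`. -/
noncomputable def genericMatrix (K : Type*) [CommSemiring K] {E V : Type*} (r : E → V → Prop)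
    [DecidableRel r] : Matrix E V (MvPolynomial (E × V) K) :=
  fun e v => if r e v then X (e, v) else 0

theorem det_genericMatrix_submatrix_ne_zero {K : Type*} [CommRing K] [Nontrivial K] {E V : Type*}
    {r : E → V → Prop} [DecidableRel r] {F : Set E} [Fintype F] [DecidableEq F] {m : F → V}
    (hm : Function.Injective m) (hr : ∀ e : F, r e (m e)) :
    ((genericMatrix K r).submatrix Subtype.val m).det ≠ 0 := by
  classical
  intro h0
  let t (q : E × V) : K := if ∃ e : F, q = (↑e, m e) then 1 else 0
  have hone : (eval t).mapMatrix ((genericMatrix K r).submatrix Subtype.val m) = 1 := by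
    ext e e'
    have ht : t (e, m e') = if e = e' then 1 else 0 := by
      refine if_congr ⟨?_, ?_⟩ rfl rfl
      · rintro ⟨f, hf⟩
        rw [Prod.mk.injEq] at hf
        rw [Subtype.ext hf.1, hm hf.2]
      · rintro rfl
        exact ⟨e, rfl⟩
    rw [RingHom.mapMatrix_apply, Matrix.map_apply, Matrix.one_apply, Matrix.submatrix_apply,
      genericMatrix]
    by_cases hee' : e = e'
    · subst hee'
      rw [if_pos (hr e), eval_X, ht]
    · rw [apply_ite (eval t), eval_X, ht, if_neg hee', map_zero, ite_self]
  have hdet := congrArg (eval t) h0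
  rw [RingHom.map_det, hone, Matrix.det_one, map_zero] at hdet
  exact one_ne_zero hdet

theorem exists_forall_eval_ne_zero {K σ κ : Type*} [Field K] [Infinite K] [Finite κ]
    {p : κ → MvPolynomial σ K} (hp : ∀ i, p i ≠ 0) : ∃ t, ∀ i, eval t (p i) ≠ 0 := by
  obtain ⟨_⟩ := nonempty_fintype κ
  obtain ⟨t, ht⟩ : ∃ t, eval t (∏ i, p i) ≠ 0 := by
    by_contra! hcon
    exact Finset.prod_ne_zero_iff.2 (fun i _ => hp i)
      (MvPolynomial.funext fun t => by rw [hcon t, map_zero])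
  rw [map_prod, Finset.prod_ne_zero_iff] at ht
  exact ⟨t, fun i => ht i (Finset.mem_univ i)⟩

theorem exists_vectors_linearIndepOn_of_matching (K : Type*) [Field K] [Infinite K] {E V : Type*}
    [Finite E] [Finite V] (r : E → V → Prop) :
    ∃ ρ : E → V → K, (∀ e v, ¬ r e v → ρ e v = 0) ∧
      ∀ (F : Set E) (m : F → V), Function.Injective m →
        (∀ e : F, r e (m e)) → LinearIndepOn K ρ F := by
  classical
  obtain ⟨_⟩ := nonempty_fintype E
  obtain ⟨t, ht⟩ := exists_forall_eval_ne_zero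
    (κ := Σ F : Set E, {m : F → V // Function.Injective m ∧ ∀ e : F, r e (m e)})
    fun q => det_genericMatrix_submatrix_ne_zero (K := K) q.2.2.1 q.2.2.2
  refine ⟨fun e v => eval t (genericMatrix K r e v), fun e v hev => ?_, fun F m hm hr => ?_⟩
  · simp [genericMatrix, hev]
  · have hdet := ht ⟨F, m, hm, hr⟩
    rw [RingHom.map_det] at hdet
    exact LinearIndependent.of_comp (LinearMap.funLeft K K m)
      (Matrix.linearIndependent_rows_of_det_ne_zero hdet)

theorem exists_matching_of_bicircular_indep {V : Type*} [Finite V] {G : SimpleGraph V}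
    {F : Set G.edgeSet} (hF : (countMatroid G 1 0).Indep F) :
    ∃ m : F → V, Function.Injective m ∧ ∀ e : F, m e ∈ ((e : G.edgeSet) : Sym2 V) := by
  classical
  obtain ⟨_⟩ := nonempty_fintype V
  let ends (e : F) : Finset V := {v | v ∈ ((e : G.edgeSet) : Sym2 V)}
  suffices hall : ∀ S : Finset F, S.card ≤ (S.biUnion ends).card by
    simpa [ends] using (Finset.all_card_le_biUnion_card_iff_exists_injective ends).1 hall
  intro S
  rcases S.eq_empty_or_nonempty with rfl | hS
  · simp
  have hcard := (countMatroid_indep_iff G 1 0 F).1 hF (Subtype.val '' (S : Set F))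
    (Subtype.coe_image_subset F S) (hS.to_set.image _)
  have hsupp : edgeSupport G (Subtype.val '' (S : Set F)) = (S.biUnion ends : Finset V) := by
    ext v
    simp [edgeSupport, ends]
  rw [Set.ncard_image_of_injective _ Subtype.val_injective, hsupp, Set.ncard_coe_finset,
    Set.ncard_coe_finset] at hcard
  push_cast at hcard
  omega

theorem exists_vectors_bicircular (K : Type*) [Field K] [Infinite K] {V : Type*} [Finite V]
    (G : SimpleGraph V) :
    ∃ ρ : G.edgeSet → V → K, ∀ F, (countMatroid G 1 0).Indep F ↔ LinearIndepOn K ρ F := by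
  obtain ⟨ρ, hsupp, hρ⟩ := exists_vectors_linearIndepOn_of_matching K
    fun (e : G.edgeSet) v => v ∈ (e : Sym2 V)
  refine ⟨ρ, fun F => ⟨fun hF => ?_, fun hF => ?_⟩⟩
  · obtain ⟨m, hm, hmem⟩ := exists_matching_of_bicircular_indep hF
    exact hρ F m hm hmem
  · refine (countMatroid_indep_iff G 1 0 F).2 fun I hIF _ => ?_
    have hcard := ncard_le_of_linearIndepOn_of_support_subset (hF.mono hIF)
      fun e he v (hv : v ∉ edgeSupport G I) => hsupp e v fun hve => hv ⟨e, he, hve⟩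
    push_cast
    omega

/-! ### Ranks in count matroids -/

section CountMatroid

variable {V : Type*} [Finite V] (G : SimpleGraph V) {k l : ℕ}

theorem countMatroid_indep_insert_of_notMem_edgeSupport (hl : l < 2 * k) {T : Set G.edgeSet}
    (hT : (countMatroid G k l).Indep T) {e : G.edgeSet} {v : V} (hv : v ∈ (e : Sym2 V))
    (hvT : v ∉ edgeSupport G T) : (countMatroid G k l).Indep (insert e T) := by
  rw [countMatroid_indep_iff] at hT ⊢
  intro I hI hne
  by_cases heI : e ∈ I
  · have hsub : I \ {e} ⊆ T := fun x hx => (hI hx.1).resolve_left hx.2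
    have hcard := Set.ncard_sdiff_singleton_add_one heI
    rcases (I \ {e}).eq_empty_or_nonempty with hempty | hne'
    · have hsupp := two_le_ncard_edgeSupport G hne
      rw [hempty, Set.ncard_empty] at hcard
      rw [← hcard]
      push_cast
      nlinarith
    · have hcount := hT _ hsub hne'
      have hsupp : (edgeSupport G (I \ {e})).ncard < (edgeSupport G I).ncard :=
        Set.ncard_lt_ncard ⟨edgeSupport_mono G Set.sdiff_subset, fun h =>
          hvT (edgeSupport_mono G hsub (h ⟨e, heI, hv⟩))⟩
      rw [← hcard]
      push_cast
      nlinarith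
  · exact hT I (fun x hx => (hI hx).resolve_left fun h => heI (h ▸ hx)) hne

theorem countMatroid_indep_insert_of_indep_succ (hl : l < 2 * k) {T : Set G.edgeSet}
    (hT : (countMatroid G k (l + 1)).Indep T) (e : G.edgeSet) :
    (countMatroid G k l).Indep (insert e T) := by
  rw [countMatroid_indep_iff] at hT ⊢
  intro I hI hne
  have hcard : (I.ncard : ℤ) ≤ (I \ {e}).ncard + 1 := by
    exact_mod_cast Set.ncard_singleton e ▸ Set.ncard_le_ncard_sdiff_add_ncard I {e}
  rcases (I \ {e}).eq_empty_or_nonempty with hempty | hne'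
  · have hsupp := two_le_ncard_edgeSupport G hne
    rw [hempty, Set.ncard_empty] at hcard
    push_cast at hcard
    nlinarith
  · have hcount := hT _ (fun x hx => (hI hx.1).resolve_left hx.2) hne'
    have hsupp := Set.ncard_le_ncard (edgeSupport_mono G (Set.sdiff_subset : I \ {e} ⊆ I))
    push_cast at hcount
    nlinarith

theorem countMatroid_indep_singleton (hl : l < 2 * k) (e : G.edgeSet) :
    (countMatroid G k l).Indep {e} := by
  obtain ⟨v, w, -, he⟩ := exists_ne_and_edge_eq_mk G e
  rw [← insert_empty_eq]
  exact countMatroid_indep_insert_of_notMem_edgeSupport G hl (Matroid.empty_indep _)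
    (v := v) (by simp [he]) (by simp [edgeSupport])

theorem matroidRank_countMatroid_le {X : Set G.edgeSet} {S : Set V} (hS : edgeSupport G X ⊆ S)
    (hl : l ≤ k * S.ncard) : matroidRank (countMatroid G k l) X ≤ k * S.ncard - l := by
  obtain ⟨I, hIX, hI, hcard⟩ := exists_indep_ncard_eq_matroidRank (countMatroid G k l) X
  rw [← hcard]
  rcases I.eq_empty_or_nonempty with rfl | hne
  · rw [Set.ncard_empty, Nat.cast_zero, sub_nonneg]
    exact_mod_cast hl
  · calc (I.ncard : ℤ) ≤ k * (edgeSupport G I).ncard - l :=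
          (countMatroid_indep_iff G k l I).1 hI I subset_rfl hne
      _ ≤ k * S.ncard - l := by
          gcongr
          exacts [S.toFinite, (edgeSupport_mono G hIX).trans hS]

theorem countMatroid_indep_union_of_disjoint_edgeSupport {A B : Set G.edgeSet}
    (hA : (countMatroid G k l).Indep A) (hB : (countMatroid G k l).Indep B)
    (hAB : Disjoint (edgeSupport G A) (edgeSupport G B)) :
    (countMatroid G k l).Indep (A ∪ B) := by
  rw [countMatroid_indep_iff] at hA hB ⊢
  intro I hI hne
  obtain ⟨I₁, I₂, rfl, h₁, h₂⟩ : ∃ I₁ I₂, I = I₁ ∪ I₂ ∧ I₁ ⊆ A ∧ I₂ ⊆ B :=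
    ⟨I ∩ A, I ∩ B, by rw [← Set.inter_union_distrib_left, Set.inter_eq_left.2 hI],
      Set.inter_subset_right, Set.inter_subset_right⟩
  rcases I₁.eq_empty_or_nonempty with rfl | hne₁
  · rw [Set.empty_union] at hne ⊢
    exact hB I₂ h₂ hne
  rcases I₂.eq_empty_or_nonempty with rfl | hne₂
  · rw [Set.union_empty] at hne ⊢
    exact hA I₁ h₁ hne
  have hcard : ((I₁ ∪ I₂).ncard : ℤ) ≤ I₁.ncard + I₂.ncard := by
    exact_mod_cast Set.ncard_union_le I₁ I₂
  rw [edgeSupport_union, Set.ncard_union_eq (hAB.mono (edgeSupport_mono G h₁)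
    (edgeSupport_mono G h₂))]
  push_cast
  linarith [hA I₁ h₁ hne₁, hB I₂ h₂ hne₂, Int.natCast_nonneg l]

theorem matroidRank_countMatroid_add_le_of_disjoint_edgeSupport (k l : ℕ) {A B : Set G.edgeSet}
    (hAB : Disjoint (edgeSupport G A) (edgeSupport G B)) :
    matroidRank (countMatroid G k l) A + matroidRank (countMatroid G k l) B ≤
      matroidRank (countMatroid G k l) (A ∪ B) := by
  obtain ⟨I, hIA, hI, hIcard⟩ := exists_indep_ncard_eq_matroidRank (countMatroid G k l) A
  obtain ⟨J, hJB, hJ, hJcard⟩ := exists_indep_ncard_eq_matroidRank (countMatroid G k l) B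
  have hIJ := hAB.mono (edgeSupport_mono G hIA) (edgeSupport_mono G hJB)
  have hrank := ncard_le_matroidRank_of_indep
    (countMatroid_indep_union_of_disjoint_edgeSupport G hI hJ hIJ)
    (Set.union_subset_union hIA hJB)
  rw [Set.ncard_union_eq (disjoint_of_disjoint_edgeSupport G hIJ)] at hrank
  push_cast at hrank
  linarith

end CountMatroid

/-- A set of edges is connected if it is not the union of two nonempty subsets without a common
vertex. This is connectedness of the subgraph formed by the edges and their endpoints. -/
def EdgeConnected {V : Type*} (G : SimpleGraph V) (I : Set G.edgeSet) : Prop :=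
  ∀ A ⊆ I, A.Nonempty → (I \ A).Nonempty →
    ¬ Disjoint (edgeSupport G A) (edgeSupport G (I \ A))

section EdgeConnected

variable {V : Type*} {G : SimpleGraph V} {I : Set G.edgeSet}

theorem EdgeConnected.exists_edgeSupport_insert_eq (hI : EdgeConnected G I) {T : Set G.edgeSet}
    (hTI : T ⊆ I) (hT : T.Nonempty) (hne : edgeSupport G T ≠ edgeSupport G I) :
    ∃ e ∈ I, ∃ w ∈ (e : Sym2 V), w ∉ edgeSupport G T ∧
      edgeSupport G (insert e T) = insert w (edgeSupport G T) := by
  let A : Set G.edgeSet := {e ∈ I | edgeSupport G {e} ⊆ edgeSupport G T}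
  have hTA : T ⊆ A := fun e he =>
    ⟨hTI he, edgeSupport_mono G (Set.singleton_subset_iff.2 he)⟩
  have hAT : edgeSupport G A ⊆ edgeSupport G T := fun v ⟨e, he, hv⟩ => he.2 ⟨e, rfl, hv⟩
  have hIA : (I \ A).Nonempty := by
    rw [Set.sdiff_nonempty]
    exact fun h => hne ((edgeSupport_mono G hTI).antisymm ((edgeSupport_mono G h).trans hAT))
  obtain ⟨v, hvA, e, ⟨heI, heA⟩, hve⟩ :=
    Set.not_disjoint_iff.1 (hI A (fun e he => he.1) (hT.mono hTA) hIA)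
  obtain ⟨w, hw, hwT⟩ := Set.not_subset.1 fun h => heA ⟨heI, h⟩
  rw [edgeSupport_singleton] at hw
  have hvT : v ∈ edgeSupport G T := hAT hvA
  have he : (e : Sym2 V) = s(v, w) :=
    (Sym2.mem_and_mem_iff fun h : v = w => hwT (h ▸ hvT)).1 ⟨hve, hw⟩
  refine ⟨e, heI, w, hw, hwT, ?_⟩
  have hpair : edgeSupport G {e} = {v, w} := by
    ext x
    simp [edgeSupport_singleton, he]
  rw [Set.insert_eq, edgeSupport_union, hpair, Set.insert_union, Set.singleton_union,
    Set.insert_comm, Set.insert_eq_of_mem hvT]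

variable [Finite V]

theorem EdgeConnected.exists_spanning_tree (hI : EdgeConnected G I) (hne : I.Nonempty) :
    ∃ T ⊆ I, (countMatroid G 1 1).Indep T ∧ T.ncard + 1 = (edgeSupport G I).ncard := by
  let IsSubtree (T : Set G.edgeSet) : Prop := T ⊆ I ∧ T.Nonempty ∧
    (countMatroid G 1 1).Indep T ∧ T.ncard + 1 = (edgeSupport G T).ncard
  obtain ⟨e₀, he₀⟩ := hne
  have he₀tree : IsSubtree {e₀} := ⟨Set.singleton_subset_iff.2 he₀, Set.singleton_nonempty e₀,
    countMatroid_indep_singleton G one_lt_two e₀,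
    by rw [Set.ncard_singleton, ncard_edgeSupport_singleton]⟩
  obtain ⟨T, -, hT⟩ := Finite.exists_le_maximal he₀tree
  obtain ⟨hTI, hTne, hTind, hTcard⟩ := hT.prop
  refine ⟨T, hTI, hTind, ?_⟩
  rw [hTcard]
  by_contra hspan
  obtain ⟨e, heI, w, hwe, hwT, hsupp⟩ :=
    hI.exists_edgeSupport_insert_eq hTI hTne fun h => hspan (congrArg Set.ncard h)
  have heT : e ∉ T := fun h => hwT ⟨e, h, hwe⟩
  have hinsert : IsSubtree (insert e T) := ⟨Set.insert_subset heI hTI, Set.insert_nonempty e T,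
    countMatroid_indep_insert_of_notMem_edgeSupport G one_lt_two hTind hwe hwT,
    by rw [hsupp, Set.ncard_insert_of_notMem heT, Set.ncard_insert_of_notMem hwT, hTcard]⟩
  exact heT (hT.le_of_ge hinsert (Set.subset_insert e T) (Set.mem_insert e T))

theorem EdgeConnected.min_le_matroidRank (hI : EdgeConnected G I) (hne : I.Nonempty) {l : ℕ}
    (hl : l ≤ 1) :
    min (I.ncard : ℤ) ((edgeSupport G I).ncard - l) ≤ matroidRank (countMatroid G 1 l) I := by
  obtain ⟨T, hTI, hT, hcard⟩ := hI.exists_spanning_tree hne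
  zify at hcard
  obtain rfl | rfl := Nat.le_one_iff_eq_zero_or_eq_one.1 hl
  · by_cases hIT : I ⊆ T
    · obtain ⟨e, -⟩ := hne
      have hind : (countMatroid G 1 0).Indep I :=
        (countMatroid_indep_insert_of_indep_succ G two_pos hT e).subset
          (hIT.trans (Set.subset_insert e T))
      exact (min_le_left _ _).trans (matroidRank_eq_ncard_of_indep hind).ge
    · obtain ⟨e, heI, heT⟩ := Set.not_subset.1 hIT
      have hrank := ncard_le_matroidRank_of_indep
        (countMatroid_indep_insert_of_indep_succ G two_pos hT e) (Set.insert_subset heI hTI)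
      rw [Set.ncard_insert_of_notMem heT] at hrank
      push_cast at hrank ⊢
      exact (min_le_right _ _).trans (by linarith)
  · have hrank := ncard_le_matroidRank_of_indep hT hTI
    push_cast
    exact (min_le_right _ _).trans (by linarith)

end EdgeConnected

/-- Ranks are superadditive over vertex-disjoint unions, which reduces the bound to connected
sets. -/
theorem ncard_add_le_sum_matroidRank_of_countMatroid_indep {V : Type*} [Finite V]
    (G : SimpleGraph V) {d : ℕ} {l : Fin (d + 1) → ℕ} (hl : ∀ i, l i ≤ 1) {I : Set G.edgeSet}
    (hI : (countMatroid G (d + 1) (∑ i, l i + d)).Indep I) (hne : I.Nonempty) :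
    (I.ncard : ℤ) + d ≤ ∑ i, matroidRank (countMatroid G 1 (l i)) I := by
  induction hn : I.ncard using Nat.strong_induction_on generalizing I with
  | _ n ih =>
  subst hn
  by_cases hconn : EdgeConnected G I
  · have hrank := Finset.sum_le_sum fun i (_ : i ∈ Finset.univ) =>
      hconn.min_le_matroidRank hne (hl i)
    refine le_trans ?_ hrank
    rcases lt_or_ge I.ncard (edgeSupport G I).ncard with hlt | hge
    · have hpos := (Set.ncard_pos I.toFinite).2 hne
      have hmin (i : Fin (d + 1)) :
          min (I.ncard : ℤ) ((edgeSupport G I).ncard - l i) = I.ncard := by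
        have := hl i
        omega
      simp only [hmin, Finset.sum_const, Finset.card_univ, Fintype.card_fin, nsmul_eq_mul]
      push_cast
      nlinarith
    · have hmin (i : Fin (d + 1)) : min (I.ncard : ℤ) ((edgeSupport G I).ncard - l i) =
          (edgeSupport G I).ncard - l i := by omega
      have hcount := (countMatroid_indep_iff G _ _ I).1 hI I subset_rfl hne
      simp only [hmin, Finset.sum_sub_distrib, Finset.sum_const, Finset.card_univ,
        Fintype.card_fin, nsmul_eq_mul]
      push_cast at hcount ⊢
      linarith
  · simp only [EdgeConnected, not_forall, not_not] at hconn
    obtain ⟨A, hAI, hA, hIA, hdisj⟩ := hconn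
    have hcard := Set.ncard_sdiff_add_ncard_of_subset hAI
    have hApos := (Set.ncard_pos A.toFinite).2 hA
    have hIApos := (Set.ncard_pos (I \ A).toFinite).2 hIA
    have hA_le := ih _ (by omega) (hI.subset hAI) hA rfl
    have hIA_le := ih _ (by omega) (hI.subset Set.sdiff_subset) hIA rfl
    have hrank := Finset.sum_le_sum fun i (_ : i ∈ Finset.univ) =>
      matroidRank_countMatroid_add_le_of_disjoint_edgeSupport G 1 (l i) hdisj
    rw [Set.union_sdiff_cancel hAI, Finset.sum_add_distrib] at hrank
    omega

theorem inducedMatroid_bernsteinFunction_eq_countMatroid {V : Type*} [Finite V]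
    (G : SimpleGraph V) {d : ℕ} {L : Fin (d + 1) → Submodule ℂ (G.edgeSet → ℂ)}
    {l : Fin (d + 1) → ℕ} (hl : ∀ i, l i ≤ 1)
    (hL : ∀ i, linearSpaceMatroid (L i) = countMatroid G 1 (l i)) :
    inducedMatroid (bernsteinFunction L) = countMatroid G (d + 1) (∑ i, l i + d) := by
  have hbern (I : Set G.edgeSet) : (bernsteinFunction L).toFun I =
      ∑ i, matroidRank (countMatroid G 1 (l i)) I - d := by
    simp [bernsteinFunction, hL]
  refine Matroid.ext_indep rfl fun F _ => ⟨fun hF => ?_, fun hF => ?_⟩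
  · rw [inducedMatroid_indep_iff] at hF
    refine (countMatroid_indep_iff G _ _ F).2 fun I hIF hI => (hF I hIF hI).trans ?_
    have hsupp := two_le_ncard_edgeSupport G hI
    have hrank := Finset.sum_le_sum fun i (_ : i ∈ Finset.univ) =>
      matroidRank_countMatroid_le G (k := 1) (l := l i) (subset_refl (edgeSupport G I))
        (by have := hl i; omega)
    simp only [Finset.sum_sub_distrib, Finset.sum_const, Finset.card_univ, Fintype.card_fin,
      nsmul_eq_mul] at hrank
    rw [hbern]
    push_cast at hrank ⊢
    linarith
  · refine (inducedMatroid_indep_iff _ F).2 fun I hIF hI => ?_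
    rw [hbern, le_sub_iff_add_le]
    exact ncard_add_le_sum_matroidRank_of_countMatroid_indep G hl (hF.subset hIF) hI

theorem inducedMatroid_bernsteinFunction_eq_countMatroid_three_four {V : Type*} [Finite V]
    {G : SimpleGraph V} {L : Fin 3 → Submodule ℂ (G.edgeSet → ℂ)}
    (hL : ∀ i, linearSpaceMatroid (L i) = countMatroid G 1 (![1, 1, 0] i)) :
    inducedMatroid (bernsteinFunction L) = countMatroid G 3 4 := by
  rw [inducedMatroid_bernsteinFunction_eq_countMatroid G (by decide) hL]
  simp [Fin.sum_univ_three]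

theorem exists_ne_zero_of_linearSpaceMatroid_eq_countMatroid {V : Type*} [Finite V]
    {G : SimpleGraph V} {k l : ℕ} (hl : l < 2 * k) {L : Submodule ℂ (G.edgeSet → ℂ)}
    (hL : linearSpaceMatroid L = countMatroid G k l) (e : G.edgeSet) : ∃ x ∈ L, x e ≠ 0 := by
  rw [← linearSpaceMatroid_indep_singleton_iff, hL]
  exact countMatroid_indep_singleton G hl e

/-! ### The cyclic chain of four blocks -/

theorem image_val_subset_image_offDiag {V : Type*} [DecidableEq V] (G : SimpleGraph V)
    {F : Set G.edgeSet} {S : Finset V} (hF : edgeSupport G F ⊆ S) :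
    Subtype.val '' F ⊆ (S.offDiag.image (Function.uncurry Sym2.mk) : Finset (Sym2 V)) := by
  rintro _ ⟨e, he, rfl⟩
  obtain ⟨v, w, hvw, hmk⟩ := exists_ne_and_edge_eq_mk G e
  exact Finset.mem_coe.2 (Finset.mem_image.2 ⟨(v, w), Finset.mem_offDiag.2
    ⟨hF ⟨e, he, by simp [hmk]⟩, hF ⟨e, he, by simp [hmk]⟩, hvw⟩, hmk.symm⟩)

theorem ncard_le_choose_edgeSupport {V : Type*} [Finite V] (G : SimpleGraph V)
    (F : Set G.edgeSet) : F.ncard ≤ (edgeSupport G F).ncard.choose 2 := by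
  classical
  obtain ⟨S, hS⟩ := (edgeSupport G F).toFinite.exists_finset_coe
  rw [← hS, Set.ncard_coe_finset, ← Sym2.card_image_offDiag, ← Set.ncard_coe_finset,
    ← Set.ncard_image_of_injective F Subtype.val_injective]
  exact Set.ncard_le_ncard (image_val_subset_image_offDiag G hS.ge)

instance : DecidableRel hubGraph.Adj := fun p q => by unfold hubGraph; infer_instance

theorem card_edgeSet_hubGraph : Nat.card hubGraph.edgeSet = 56 := by
  have hsum := hubGraph.sum_degrees_eq_twice_card_edges
  have hdegrees : ∑ v, hubGraph.degree v = 112 := by decide +kernel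
  rw [Nat.card_eq_fintype_card, ← SimpleGraph.edgeFinset_card]
  omega

/-- The vertex set of the `i`-th copy of `K₆` minus an edge. -/
def hubBlock (i : Fin 4) : Finset (Fin 4 × Fin 5) := {p | p.1 = i ∨ p = (i + 1, 0)}

theorem mem_hubBlock {i : Fin 4} {p : Fin 4 × Fin 5} :
    p ∈ hubBlock i ↔ p.1 = i ∨ p = (i + 1, 0) := by
  simp [hubBlock]

theorem card_hubBlock (i : Fin 4) : (hubBlock i).card = 6 := by
  decide +revert

theorem hubBlock_inter_hubBlock_succ (i : Fin 4) :
    hubBlock i ∩ hubBlock (i + 1) = {(i + 1, 0)} := by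
  decide +revert

theorem exists_edgeSupport_subset_hubBlock (e : hubGraph.edgeSet) :
    ∃ i, edgeSupport hubGraph {e} ⊆ hubBlock i := by
  obtain ⟨e, he⟩ := e
  simp only [edgeSupport_singleton]
  induction e using Sym2.ind with
  | _ p q =>
  suffices h : ∃ i, p ∈ hubBlock i ∧ q ∈ hubBlock i by
    simpa [Set.subset_def] using h
  simp only [mem_hubBlock]
  rcases he with ⟨hpq, -⟩ | ⟨hq, -, hq₀⟩ | ⟨hp, -, hp₀⟩
  · exact ⟨p.1, Or.inl rfl, Or.inl hpq.symm⟩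
  · exact ⟨p.1, Or.inl rfl, Or.inr (Prod.ext hq hq₀)⟩
  · exact ⟨q.1, Or.inr (Prod.ext hp hp₀), Or.inl rfl⟩

/-- The index of the block that contains both ends of an edge; it is unique since distinct blocks
share at most one vertex. -/
noncomputable def edgeBlock (e : hubGraph.edgeSet) : Fin 4 :=
  (exists_edgeSupport_subset_hubBlock e).choose

theorem edgeSupport_subset_hubBlock {F : Set hubGraph.edgeSet} {i : Fin 4}
    (hF : ∀ e ∈ F, edgeBlock e = i) : edgeSupport hubGraph F ⊆ hubBlock i := by
  rintro v ⟨e, he, hv⟩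
  rw [← hF e he]
  exact (exists_edgeSupport_subset_hubBlock e).choose_spec ⟨e, rfl, hv⟩

theorem ncard_le_fourteen_of_edgeBlock_eq {F : Set hubGraph.edgeSet} {i : Fin 4}
    (hF : ∀ e ∈ F, edgeBlock e = i) : F.ncard ≤ 14 := by
  let pairs := (hubBlock i).offDiag.image (Function.uncurry Sym2.mk)
  have hmem : s((i, 0), (i + 1, 0)) ∈ pairs :=
    Finset.mem_image.2 ⟨((i, 0), (i + 1, 0)), by simp [Finset.mem_offDiag, mem_hubBlock], rfl⟩
  have hnonadj : s((i, 0), (i + 1, 0)) ∉ (Subtype.val '' F : Set (Sym2 (Fin 4 × Fin 5))) := by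
    rintro ⟨⟨-, hadj⟩, -, rfl⟩
    simp [hubGraph] at hadj
  have hcard : (pairs.erase s((i, 0), (i + 1, 0))).card = 14 := by
    rw [Finset.card_erase_of_mem hmem, Sym2.card_image_offDiag, card_hubBlock]
    rfl
  rw [← hcard, ← Set.ncard_image_of_injective F Subtype.val_injective, ← Set.ncard_coe_finset,
    Finset.coe_erase]
  exact Set.ncard_le_ncard (Set.subset_sdiff_singleton
    (image_val_subset_image_offDiag hubGraph (edgeSupport_subset_hubBlock hF)) hnonadj)

theorem ncard_add_four_le_of_edgeBlock_eq {F : Set hubGraph.edgeSet} {i : Fin 4}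
    (hF : ∀ e ∈ F, edgeBlock e = i) (hne : F.Nonempty) :
    F.ncard + 4 ≤ 3 * (edgeSupport hubGraph F).ncard := by
  have hsupp_ge := two_le_ncard_edgeSupport hubGraph hne
  have hsupp_le := Set.ncard_le_ncard (edgeSupport_subset_hubBlock hF)
  rw [Set.ncard_coe_finset, card_hubBlock] at hsupp_le
  have hfourteen := ncard_le_fourteen_of_edgeBlock_eq hF
  have hchoose := ncard_le_choose_edgeSupport hubGraph F
  rw [Nat.choose_two_right] at hchoose
  generalize (edgeSupport hubGraph F).ncard = v at *
  interval_cases v <;> omega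

theorem sum_ncard_le_ncard_iUnion_add {α κ : Type*} [Finite α] [Fintype κ] (A : κ → Set α)
    (σ : κ → κ) (h : Pairwise (Function.onFun Disjoint fun i => A i \ A (σ i))) :
    ∑ i, (A i).ncard ≤ (⋃ i, A i).ncard + ∑ i, (A i ∩ A (σ i)).ncard := by
  have hdiff : ∑ i, (A i \ A (σ i)).ncard ≤ (⋃ i, A i).ncard := by
    rw [← finsum_eq_sum_of_fintype, ← Set.ncard_iUnion_of_finite (fun i => Set.toFinite _) h]
    exact Set.ncard_le_ncard (Set.iUnion_mono fun i => Set.sdiff_subset)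
  calc ∑ i, (A i).ncard = ∑ i, (A i \ A (σ i)).ncard + ∑ i, (A i ∩ A (σ i)).ncard := by
        rw [← Finset.sum_add_distrib]
        exact Finset.sum_congr rfl fun i _ =>
          ((add_comm _ _).trans (Set.ncard_inter_add_ncard_sdiff_eq_ncard _ _)).symm
    _ ≤ _ := Nat.add_le_add_right hdiff _

theorem pairwise_disjoint_sdiff_succ_of_subset_hubBlock {A : Fin 4 → Set (Fin 4 × Fin 5)}
    (hA : ∀ i, A i ⊆ hubBlock i) :
    Pairwise (Function.onFun Disjoint fun i => A i \ A (i + 1)) := by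
  intro i j hij
  rw [Function.onFun, Set.disjoint_left]
  rintro p ⟨hpi, hpi'⟩ ⟨hpj, hpj'⟩
  rcases mem_hubBlock.1 (hA i hpi) with hi | hi <;> rcases mem_hubBlock.1 (hA j hpj) with hj | hj
  · exact hij (hi.symm.trans hj)
  · obtain rfl : j + 1 = i := by rw [← hi, hj]
    exact hpj' hpi
  · obtain rfl : i + 1 = j := by rw [← hj, hi]
    exact hpi' hpj
  · exact hij (add_right_cancel (congrArg Prod.fst (hi.symm.trans hj)))

theorem ncard_inter_succ_le_of_subset_hubBlock {A : Fin 4 → Set (Fin 4 × Fin 5)}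
    (hA : ∀ i, A i ⊆ hubBlock i) {N : Finset (Fin 4)} (hN : ∀ i ∉ N, A i = ∅) (i : Fin 4) :
    (A i ∩ A (i + 1)).ncard ≤ if i ∈ N ∧ i + 1 ∈ N then 1 else 0 := by
  split_ifs with h
  · have hsub : A i ∩ A (i + 1) ⊆ {(i + 1, 0)} := by
      have := Set.inter_subset_inter (hA i) (hA (i + 1))
      rwa [← Finset.coe_inter, hubBlock_inter_hubBlock_succ, Finset.coe_singleton] at this
    simpa using Set.ncard_le_ncard hsub
  · rcases not_and_or.1 h with h | h <;> simp [hN _ h]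

theorem three_mul_card_filter_succ_mem_add_four_le {N : Finset (Fin 4)} (hN : N.Nonempty) :
    3 * ({i | i ∈ N ∧ i + 1 ∈ N} : Finset (Fin 4)).card + 4 ≤ 4 * N.card := by
  decide +revert

/-- Each block contributes at least `4` to `3|V(F)| - |F|`, and each vertex shared by two blocks
takes away only `3`; when all four blocks occur, `4 · 4 - 4 · 3 = 4` remains. -/
theorem countMatroid_three_four_hubGraph_indep_univ :
    (countMatroid hubGraph 3 4).Indep Set.univ := by
  classical
  refine (countMatroid_indep_iff hubGraph 3 4 _).2 fun F _ hne => ?_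
  let block (i : Fin 4) : Set hubGraph.edgeSet := {e ∈ F | edgeBlock e = i}
  let A (i : Fin 4) : Set (Fin 4 × Fin 5) := edgeSupport hubGraph (block i)
  let N : Finset (Fin 4) := {i | (block i).Nonempty}
  have hA (i : Fin 4) : A i ⊆ hubBlock i := edgeSupport_subset_hubBlock fun e he => he.2
  have hempty (i : Fin 4) (hi : i ∉ N) : block i = ∅ := by
    simpa [N, Set.not_nonempty_iff_eq_empty] using hi
  have hN : N.Nonempty := by
    obtain ⟨e, he⟩ := hne
    exact ⟨edgeBlock e, Finset.mem_filter.2 ⟨Finset.mem_univ _, e, he, rfl⟩⟩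
  have hF : ⋃ i, block i = F := by
    ext e
    simp [block]
  have hcard : F.ncard ≤ ∑ i, (block i).ncard := hF ▸ Set.ncard_iUnion_le_of_fintype block
  have hblock (i : Fin 4) : (block i).ncard + (if i ∈ N then 4 else 0) ≤ 3 * (A i).ncard := by
    split_ifs with hi
    · exact ncard_add_four_le_of_edgeBlock_eq (fun e he => he.2) (Finset.mem_filter.1 hi).2
    · simp [hempty i hi]
  have hsupp : (⋃ i, A i).ncard ≤ (edgeSupport hubGraph F).ncard :=
    Set.ncard_le_ncard (Set.iUnion_subset fun i => edgeSupport_mono hubGraph fun e he => he.1)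
  have hglue := sum_ncard_le_ncard_iUnion_add A (· + 1)
    (pairwise_disjoint_sdiff_succ_of_subset_hubBlock hA)
  have hinter := Finset.sum_le_sum fun i (_ : i ∈ Finset.univ) =>
    ncard_inter_succ_le_of_subset_hubBlock hA (N := N)
      (fun i hi => by simp [A, hempty i hi, edgeSupport]) i
  have hsum := Finset.sum_le_sum fun i (_ : i ∈ Finset.univ) => hblock i
  rw [Finset.sum_boole, Nat.cast_id] at hinter
  rw [Finset.sum_add_distrib, ← Finset.mul_sum, Finset.sum_ite_mem, Finset.univ_inter,
    Finset.sum_const, smul_eq_mul] at hsum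
  have hcycle := three_mul_card_filter_succ_mem_add_four_le hN
  push_cast
  omega

theorem matroidRank_graphic_edgeBlock_le {F : Set hubGraph.edgeSet} {i : Fin 4}
    (hF : ∀ e ∈ F, edgeBlock e = i) : matroidRank (countMatroid hubGraph 1 1) F ≤ 5 := by
  have hrank := matroidRank_countMatroid_le hubGraph (k := 1) (l := 1)
    (edgeSupport_subset_hubBlock hF) (by rw [Set.ncard_coe_finset, card_hubBlock]; norm_num)
  rw [Set.ncard_coe_finset, card_hubBlock] at hrank
  norm_num at hrank
  exact hrank

theorem hadamardMatroid_hubGraph_not_indep_univ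
    {L : Fin 3 → Submodule ℂ (hubGraph.edgeSet → ℂ)}
    (hL : ∀ i, linearSpaceMatroid (L i) = countMatroid hubGraph 1 (![1, 1, 0] i)) :
    ¬ (hadamardMatroid L).Indep Set.univ := by
  intro hind
  rw [hadamardMatroid_indep_iff, ← Finset.coe_univ] at hind
  have hcard := card_le_of_algIndep_hadamardProduct hind
    fun e => ![edgeBlock e, edgeBlock e, 0]
  have hscalars : (Finset.univ.image fun e => ![edgeBlock e, edgeBlock e, 0]).card ≤ 4 := by
    refine (Finset.card_le_card (t := Finset.univ.image fun i : Fin 4 => ![i, i, 0]) ?_).trans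
      Finset.card_image_le
    exact Finset.image_subset_iff.2 fun e _ => Finset.mem_image_of_mem _ (Finset.mem_univ _)
  have hgraphic : ∑ g ∈ Finset.univ.image edgeBlock,
      (matroidRank (countMatroid hubGraph 1 1) {e | edgeBlock e = g} - 1) ≤ 16 := by
    refine (Finset.sum_le_card_nsmul _ _ 4 fun g _ => ?_).trans ?_
    · linarith [matroidRank_graphic_edgeBlock_le (F := {e | edgeBlock e = g}) fun e he => he]
    · have := (Finset.univ.image edgeBlock).card_le_univ
      rw [Fintype.card_fin] at this
      rw [nsmul_eq_mul]
      omega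
  have hbicircular : matroidRank (countMatroid hubGraph 1 0) Set.univ ≤ 20 := by
    simpa [Set.ncard_univ] using matroidRank_countMatroid_le hubGraph (k := 1) (l := 0)
      (Set.subset_univ (edgeSupport hubGraph Set.univ)) (Nat.zero_le _)
  have hedges : (Finset.univ : Finset hubGraph.edgeSet).card = 56 := by
    rw [Finset.card_univ, ← Nat.card_eq_fintype_card, card_edgeSet_hubGraph]
  have hne : (Finset.univ : Finset hubGraph.edgeSet).Nonempty :=
    Finset.card_pos.1 (hedges ▸ Nat.succ_pos 55)
  simp only [Fin.sum_univ_three, hL, Matrix.cons_val, Finset.mem_univ, true_and,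
    Finset.image_const hne, Finset.sum_singleton, Set.ofPred_true, hedges] at hcard
  push_cast at hcard
  linarith [(Nat.cast_le (α := ℤ)).2 hscalars]

theorem mainTheorem3 :
    -- `hubGraph` is `(3,4)`-tight
    ((countMatroid hubGraph 3 4).Indep Set.univ ∧
      (hubGraph.edgeSet.ncard : ℤ) = 3 * Fintype.card (Fin 4 × Fin 5) - 4) ∧
    -- the graphic and the bicircular matroid have representations over `ℂ`
    (∃ (m : ℕ) (X₁₁ : Matrix hubGraph.edgeSet (Fin m) ℂ),
      RepresentsRows X₁₁ (countMatroid hubGraph 1 1)) ∧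
    (∃ (n : ℕ) (X₁₀ : Matrix hubGraph.edgeSet (Fin n) ℂ),
      RepresentsRows X₁₀ (countMatroid hubGraph 1 0)) ∧
    ∀ (m n : ℕ) (X₁₁ : Matrix hubGraph.edgeSet (Fin m) ℂ)
      (X₁₀ : Matrix hubGraph.edgeSet (Fin n) ℂ),
      RepresentsRows X₁₁ (countMatroid hubGraph 1 1) →
      RepresentsRows X₁₀ (countMatroid hubGraph 1 0) →
      ∀ L : Fin 3 → Submodule ℂ (hubGraph.edgeSet → ℂ),
        L = ![columnSpace X₁₁, columnSpace X₁₁, columnSpace X₁₀] →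
        -- no `L i` lies in a coordinate hyperplane
        (∀ i e, ∃ x ∈ L i, x e ≠ 0) ∧
        -- `M(L_{1,1})` and `M(L_{1,0})` are the graphic and the bicircular matroid
        linearSpaceMatroid (columnSpace X₁₁) = countMatroid hubGraph 1 1 ∧
        linearSpaceMatroid (columnSpace X₁₀) = countMatroid hubGraph 1 0 ∧
        WeakLT (hadamardMatroid L) (inducedMatroid (bernsteinFunction L)) ∧
        matroidRank (hadamardMatroid L) Set.univ ≤ 3 * Fintype.card (Fin 4 × Fin 5) - 5 ∧
        inducedMatroid (bernsteinFunction L) = countMatroid hubGraph 3 4 ∧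
        matroidRank (inducedMatroid (bernsteinFunction L)) Set.univ =
          3 * Fintype.card (Fin 4 × Fin 5) - 4 := by
  have hV : (Fintype.card (Fin 4 × Fin 5) : ℤ) = 20 := by simp
  have hE : (hubGraph.edgeSet.ncard : ℤ) = 56 := by
    rw [← Nat.card_coe_set_eq, card_edgeSet_hubGraph, Nat.cast_ofNat]
  rw [hV, hE]
  have htight := countMatroid_three_four_hubGraph_indep_univ
  obtain ⟨ρ₁₁, hρ₁₁⟩ := exists_vectors_graphic ℂ hubGraph
  obtain ⟨ρ₁₀, hρ₁₀⟩ := exists_vectors_bicircular ℂ hubGraph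
  refine ⟨⟨htight, rfl⟩, exists_representsRows_of_vectors rfl hρ₁₁,
    exists_representsRows_of_vectors rfl hρ₁₀, fun m n X₁₁ X₁₀ h₁₁ h₁₀ L hL => ?_⟩
  have hM₁₁ := h₁₁.linearSpaceMatroid_columnSpace
  have hM₁₀ := h₁₀.linearSpaceMatroid_columnSpace
  have hM : ∀ i, linearSpaceMatroid (L i) = countMatroid hubGraph 1 (![1, 1, 0] i) := by
    simp [hL, Fin.forall_fin_succ, hM₁₁, hM₁₀]
  have hl : ∀ i, (![1, 1, 0] : Fin 3 → ℕ) i < 2 * 1 := by decide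
  have hcount := inducedMatroid_bernsteinFunction_eq_countMatroid_three_four hM
  have hnot := hadamardMatroid_hubGraph_not_indep_univ hM
  refine ⟨fun i => exists_ne_zero_of_linearSpaceMatroid_eq_countMatroid (hl i) (hM i), hM₁₁, hM₁₀,
    ⟨hadamardMatroid_weakLE_inducedMatroid_bernsteinFunction L, fun h => hnot ?_⟩, ?_, hcount, ?_⟩
  · rwa [h, hcount]
  · have hrank := matroidRank_lt_ncard_of_not_indep hnot
    rw [Set.ncard_univ, Nat.card_coe_set_eq, hE] at hrank
    linarith
  · rw [hcount, matroidRank_eq_ncard_of_indep htight, Set.ncard_univ, Nat.card_coe_set_eq, hE]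
    rfl
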